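/- **Setting (Dedukti with confinement, and the theory $\mathbb{UPP}$).** *Levels* are given by $l ::= i \mid 0 \mid \mathsf S\,l \mid l\sqcup l'$, where $i$ ranges over confined variables. *Terms* are given by $$A,B,t,u ::= x \mid c \mid s \mid (x:A)\to B \mid x.\,t \mid t\,u \mid (i:A)\to B \mid i.\,t \mid t\,l,\qquad s\in\{\mathrm{Type},\mathrm{Kind}\},$$ up to renaming of bound variables; $c$ ranges over the global constants $\mathsf{Lvl},\mathsf{Ty},\mathsf{Tm},\mathsf U,\Pi,\lambda,@$ and over local constants. A *local signature* $\Phi'$ is a finite list of entries $c:A$ or $c:A:=t$ for pairwise distinct local constants $c$. The global constants have the types $$\begin{aligned} &\mathsf{Lvl}:\mathrm{Type},\quad \mathsf{Ty}:(l:\mathsf{Lvl})\to\mathrm{Type},\quad \mathsf{Tm}:(l:\mathsf{Lvl})\to\mathsf{Ty}\,l\to\mathrm{Type},\quad \mathsf U:(l:\mathsf{Lvl})\to\mathsf{Ty}\,(\mathsf S\,l),\\ &\Pi:(l\,l':\mathsf{Lvl})\to(A:\mathsf{Ty}\,l)\to(B:\mathsf{Tm}\,l\,A\to\mathsf{Ty}\,l')\to\mathsf{Ty}\,(l\sqcup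 l'),\\ &\lambda:(l\,l':\mathsf{Lvl})\to(A:\mathsf{Ty}\,l)\to(B:\mathsf{Tm}\,l\,A\to\mathsf{Ty}\,l')\to((x:\mathsf{Tm}\,l\,A)\to\mathsf{Tm}\,l'\,(B\,x))\to\mathsf{Tm}\,(l\sqcup l')\,(\Pi\,l\,l'\,A\,B),\\ &@:(l\,l':\mathsf{Lvl})\to(A:\mathsf{Ty}\,l)\to(B:\mathsf{Tm}\,l\,A\to\mathsf{Ty}\,l')\to(t:\mathsf{Tm}\,(l\sqcup l')\,(\Pi\,l\,l'\,A\,B))\to(u:\mathsf{Tm}\,l\,A)\to\mathsf{Tm}\,l'\,(B\,u). \end{aligned}$$ Let $\longrightarrow$ be the closure by context of the following rules: $(x.t)\,u\to t[x\mapsto u]$; $(i.t)\,l\to t[i\mapsto l]$; $c\to t$ for $c:A:=t$ in $\Phi'$; $\mathsf{Tm}\,l'\,(\mathsf U\,l)\to\mathsf{Ty}\,l$; and $@\,l\,l'\,A\,B\,(\lambda\,l''\,l'''\,A'\,B'\,t)\,u\to t\,u$. Let $\simeq$ be the congruence on levels and terms generated by all instances of $l_1\sqcup(l_2\sqcup l_3)\simeq(l_1\sqcup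 l_2)\sqcup l_3$, $l_1\sqcup l_2\simeq l_2\sqcup l_1$, $\mathsf S(l_1\sqcup l_2)\simeq\mathsf S\,l_1\sqcup\mathsf S\,l_2$, $l\sqcup\mathsf S\,l\simeq\mathsf S\,l$, $l\sqcup 0\simeq l$, $l\sqcup l\simeq l$. Let $\equiv$ be the equivalence relation generated by $\longrightarrow\cup\simeq$. *Contexts* are finite lists of entries $x:A$ or $i:A$ for distinct variables. The judgments $\Gamma\vdash$, $\Gamma\vdash t:A$, $\Gamma\vdash l:A$ are inductively defined as follows. - $\cdot\vdash$. If $\Gamma\vdash A:\mathrm{Type}$, then $\Gamma,x:A\vdash$ and $\Gamma,i:A\vdash$. - If $\Gamma\vdash$, then $\Gamma\vdash\mathrm{Type}:\mathrm{Kind}$, every entry $x:A$ or $i:A$ of $\Gamma$ gives $\Gamma\vdash x:A$ or $\Gamma\vdash i:A$, and every global or local constant $c$ of declared type $A$ gives $\Gamma\vdash c:A$. - If $\Gamma\vdash$, then $\Gamma\vdash 0:\mathsf{Lvl}$. If $\Gamma\vdash l:\mathsf{Lvl}$ and $\Gamma\vdash l':\mathsf{Lvl}$, then $\Gamma\vdash\mathsf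 S\,l:\mathsf{Lvl}$ and $\Gamma\vdash l\sqcup l':\mathsf{Lvl}$. - If $A\equiv B$: $\Gamma\vdash t:A$ and $\Gamma\vdash B:s$ give $\Gamma\vdash t:B$; and $\Gamma\vdash l:A$ and $\Gamma\vdash B:\mathrm{Type}$ give $\Gamma\vdash l:B$. - If $\Gamma\vdash A:\mathrm{Type}$ and $\Gamma,x:A\vdash B:s$, then $\Gamma\vdash(x:A)\to B:s$, and if moreover $\Gamma,x:A\vdash t:B$ then $\Gamma\vdash x.t:(x:A)\to B$. The same two rules hold with a confined variable $i$ instead of $x$. - $\Gamma\vdash t:(x:A)\to B$ and $\Gamma\vdash u:A$ give $\Gamma\vdash t\,u:B[x\mapsto u]$; $\Gamma\vdash t:(i:A)\to B$ and $\Gamma\vdash l:A$ give $\Gamma\vdash t\,l:B[i\mapsto l]$. $\Phi'$ is *well-formed in $\mathbb{UPP}$* if, for each entry $c:A$ (resp. $c:A:=t$), $\cdot\vdash A:s$ for some sort $s$ (resp. $\cdot\vdash t:A$) is derivable using only the local entries that precede it. **Typing under constraints.** Reserve infinitely many confined variables, the *level variables*, which are neither bound in terms nor declared in the contexts $\Gamma$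 below, and fix a finite set $V$ of them (the ones inserted in the terms to elaborate). A *constraint* is a pair $l\doteq l'$ of levels. A *level substitution* $\theta$ is a substitution with finite domain that maps level variables to levels over level variables; $\theta\vDash\mathcal C$ means $l[\theta]\simeq l'[\theta]$ for all $l\doteq l'\in\mathcal C$. Let $\Xi_\theta$ be the context with an entry $j:\mathsf{Lvl}$ for each variable $j$ that occurs in $i[\theta]$ for some $i\in V$. Write $\Gamma\vdash_{\mathcal C}$ if $\Xi_\theta,\Gamma[\theta]\vdash$ for every $\theta\vDash\mathcal C$, and $\Gamma\vdash_{\mathcal C}t:A$ if $\Xi_\theta,\Gamma[\theta]\vdash t[\theta]:A[\theta]$ for every $\theta\vDash\mathcal C$. **The bidirectional system.** Write $t\longrightarrow^{\mathrm{wh}}u$ if $t\longrightarrow^*u$ and, whenever $u\longrightarrow^*u'\,a_1\dots a_k$ ($k\ge0$, each $a_m$ a term or a level), $u'$ is not an instance of the left-hand side of a rule of $\longrightarrow$. Constrained conversion is inductively defined as follows. - If $A\longrightarrow^{\mathrm{wh}}A'$, $B\longrightarrow^{\mathrm{wh}}B'$ and $A'\equiv_{\mathrm{whnf}}B'\downarrow\mathcal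 C$, then $A\equiv B\downarrow\mathcal C$. - $t\equiv_{\mathrm{whnf}}t\downarrow\emptyset$ if $t$ is a variable $x$, a constant or a sort. - $t\equiv t'\downarrow\mathcal C$ gives $x.t\equiv_{\mathrm{whnf}}x.t'\downarrow\mathcal C$. - $A\equiv A'\downarrow\mathcal C_1$ and $B\equiv B'\downarrow\mathcal C_2$ give $(x:A)\to B\equiv_{\mathrm{whnf}}(x:A')\to B'\downarrow\mathcal C_1\cup\mathcal C_2$. - $t\equiv_{\mathrm{whnf}}t'\downarrow\mathcal C_1$ and $u\equiv u'\downarrow\mathcal C_2$ give $t\,u\equiv_{\mathrm{whnf}}t'\,u'\downarrow\mathcal C_1\cup\mathcal C_2$. - $t\equiv_{\mathrm{whnf}}t'\downarrow\mathcal C$ gives $t\,l\equiv_{\mathrm{whnf}}t'\,l'\downarrow\mathcal C\cup\{l\doteq l'\}$. The judgments *check* $\Gamma\uparrow\mathcal D\vdash t\Leftarrow A\downarrow\mathcal C$ and *infer* $\Gamma\uparrow\mathcal D\vdash t\Rightarrow A\downarrow\mathcal C$ are inductively defined as follows. - (Switch) $\Gamma\uparrow\mathcal D\vdash t\Rightarrow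 A\downarrow\mathcal C_1$ and $A\equiv B\downarrow\mathcal C_2$ give $\Gamma\uparrow\mathcal D\vdash t\Leftarrow B\downarrow\mathcal C_1\cup\mathcal C_2$. - (Abs) $C\longrightarrow^{\mathrm{wh}}(x:A)\to B$ and $\Gamma,x:A\uparrow\mathcal D\vdash t\Leftarrow B\downarrow\mathcal C$ give $\Gamma\uparrow\mathcal D\vdash x.t\Leftarrow C\downarrow\mathcal C$. - (Var) $x:A\in\Gamma$ gives $\Gamma\uparrow\mathcal D\vdash x\Rightarrow A\downarrow\emptyset$. - (Cons) If the constant $c$ has declared type $(j_1\dots j_k:\mathsf{Lvl})\to B$ and $i_1,\dots,i_k$ are level variables, then $\Gamma\uparrow\mathcal D\vdash c\,i_1\dots i_k\Rightarrow B[\vec j\mapsto\vec i]\downarrow\emptyset$. - (Sort) $\Gamma\uparrow\mathcal D\vdash\mathrm{Type}\Rightarrow\mathrm{Kind}\downarrow\emptyset$. - (Pi) $\Gamma\uparrow\mathcal D\vdash A\Leftarrow\mathrm{Type}\downarrow\mathcal C_1$, $\Gamma,x:A\uparrow\mathcal D\cup\mathcal C_1\vdash B\Rightarrow C\downarrow\mathcal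 C_2$ and $C\longrightarrow^{\mathrm{wh}}s$ give $\Gamma\uparrow\mathcal D\vdash(x:A)\to B\Rightarrow s\downarrow\mathcal C_1\cup\mathcal C_2$. - (App) $\Gamma\uparrow\mathcal D\vdash t\Rightarrow C\downarrow\mathcal C_1$, $C\longrightarrow^{\mathrm{wh}}(x:A)\to B$ and $\Gamma\uparrow\mathcal D\cup\mathcal C_1\vdash u\Leftarrow A\downarrow\mathcal C_2$ give $\Gamma\uparrow\mathcal D\vdash t\,u\Rightarrow B[x\mapsto u]\downarrow\mathcal C_1\cup\mathcal C_2$. **Theorem (soundness of the type system for computing constraints).** Let $\Phi'$ be a local signature that is well-formed in $\mathbb{UPP}$, let $\mathcal C,\mathcal D$ be sets of constraints, and let $t$ be a term whose free level variables all belong to $V$. Then, for every context $\Gamma$ and term $A$: - if $\Gamma\vdash_{\mathcal D}A:s$ for a sort $s$ and $\Gamma\uparrow\mathcal D\vdash t\Leftarrow A\downarrow\mathcal C$, then $\Gamma\vdash_{\mathcal C\cup\mathcal D}t:A$; - if $\Gamma\vdash_{\mathcal D}$ and $\Gamma\uparrow\mathcal D\vdash t\Rightarrow A\downarrow\mathcal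 C$, then $\Gamma\vdash_{\mathcal C\cup\mathcal D}t:A$. -/

import Mathlib

/-! Dedukti with confinement, instantiated at the universe-polymorphic predicative theory `UPP`
extended by a local signature, and the bidirectional system that computes level constraints.

Bound variables and context variables are de Bruijn indices, with separate index spaces for regular
variables `x` and confined variables `i`.  Free level variables (the ones inserted in schematic
terms, on which level substitutions act) are called by their name, a natural number. -/

namespace UPP

/-- The confined terms of `UPP`.  A confined variable is either a free level variable `name i`, or
the de Bruijn index `idx n` of a variable bound by `i. t`, by `(i : A) → B` or by a context entry
`i : A`. -/
inductive Level : Type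
  | name (i : ℕ)
  | idx (n : ℕ)
  | zero
  | succ (l : Level)
  | sup (l l' : Level)

/-- The global constants of `UPP`. -/
inductive Glob : Type
  | Lvl | Ty | Tm | U | Pi | Lam | App

/-- A (non-confined) constant is a global one, or a local one given by its name. -/
inductive Const : Type
  | glob (g : Glob)
  | loc (c : ℕ)

/-- The sorts of Dedukti. -/
inductive Srt : Type
  | type | kind

/-- The terms of Dedukti. -/
inductive Term : Type
  /-- A regular variable `x`. -/
  | var (n : ℕ)
  /-- A constant `c`. -/
  | const (c : Const)
  /-- A sort `s`. -/
  | sort (s : Srt)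
  /-- `(x : A) → B`. -/
  | pi (A B : Term)
  /-- `x. t`. -/
  | lam (t : Term)
  /-- `t u`. -/
  | app (t u : Term)
  /-- `(i : A) → B`. -/
  | piC (A B : Term)
  /-- `i. t`. -/
  | lamC (t : Term)
  /-- `t l`. -/
  | appC (t : Term) (l : Level)

/-! ### Renaming and substitution of de Bruijn indices -/

/-- Renaming of the confined indices of a level. -/
def Level.rename (ξ : ℕ → ℕ) : Level → Level
  | name i => name i
  | idx n => idx (ξ n)
  | zero => zero
  | succ l => succ (l.rename ξ)
  | sup l l' => sup (l.rename ξ) (l'.rename ξ)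

/-- Substitution of the confined indices of a level. -/
def Level.subst (τ : ℕ → Level) : Level → Level
  | name i => name i
  | idx n => τ n
  | zero => zero
  | succ l => succ (l.subst τ)
  | sup l l' => sup (l.subst τ) (l'.subst τ)

/-- The extension of a renaming under a binder of its index space. -/
def upRen (ρ : ℕ → ℕ) : ℕ → ℕ
  | 0 => 0
  | n + 1 => ρ n + 1

/-- Renaming of the regular indices (by `ρ`) and the confined indices (by `ξ`) of a term. -/
def Term.rename : (ρ ξ : ℕ → ℕ) → Term → Term
  | ρ, _, var n => var (ρ n)
  | _, _, const c => const c
  | _, _, sort s => sort s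
  | ρ, ξ, pi A B => pi (A.rename ρ ξ) (B.rename (upRen ρ) ξ)
  | ρ, ξ, lam t => lam (t.rename (upRen ρ) ξ)
  | ρ, ξ, app t u => app (t.rename ρ ξ) (u.rename ρ ξ)
  | ρ, ξ, piC A B => piC (A.rename ρ ξ) (B.rename ρ (upRen ξ))
  | ρ, ξ, lamC t => lamC (t.rename ρ (upRen ξ))
  | ρ, ξ, appC t l => appC (t.rename ρ ξ) (l.rename ξ)

/-- Shift under a new regular variable. -/
def Term.shift (t : Term) : Term := t.rename Nat.succ id

/-- Shift under a new confined variable. -/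
def Term.shiftC (t : Term) : Term := t.rename id Nat.succ

/-- The extension of a substitution of regular variables under a regular binder. -/
def upSub (σ : ℕ → Term) : ℕ → Term
  | 0 => .var 0
  | n + 1 => (σ n).shift

/-- The extension of a substitution of confined variables under a confined binder. -/
def upSubC (τ : ℕ → Level) : ℕ → Level
  | 0 => .idx 0
  | n + 1 => (τ n).rename Nat.succ

/-- Simultaneous substitution of the regular indices (by `σ`) and the confined indices (by `τ`). -/
def Term.subst : (σ : ℕ → Term) → (τ : ℕ → Level) → Term → Term
  | σ, _, var n => σ n
  | _, _, const c => const c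
  | _, _, sort s => sort s
  | σ, τ, pi A B => pi (A.subst σ τ) (B.subst (upSub σ) τ)
  | σ, τ, lam t => lam (t.subst (upSub σ) τ)
  | σ, τ, app t u => app (t.subst σ τ) (u.subst σ τ)
  | σ, τ, piC A B => piC (A.subst σ τ) (B.subst (fun n => (σ n).shiftC) (upSubC τ))
  | σ, τ, lamC t => lamC (t.subst (fun n => (σ n).shiftC) (upSubC τ))
  | σ, τ, appC t l => appC (t.subst σ τ) (l.subst τ)

/-- `B[x ↦ u]`, where `x` is the last regular variable of the scope of `B`. -/
def Term.inst (B u : Term) : Term :=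
  B.subst (fun n => match n with | 0 => u | n + 1 => .var n) .idx

/-- `B[i ↦ l]`, where `i` is the last confined variable of the scope of `B`. -/
def Term.instC (B : Term) (l : Level) : Term :=
  B.subst .var (fun n => match n with | 0 => l | n + 1 => .idx n)

/-! ### Free level variables and level substitutions -/

/-- The free level variables of a level. -/
def Level.names : Level → Finset ℕ
  | name i => {i}
  | idx _ => ∅
  | zero => ∅
  | succ l => l.names
  | sup l l' => l.names ∪ l'.names

/-- The free level variables of a term. -/
def Term.names : Term → Finset ℕ
  | var _ => ∅
  | const _ => ∅
  | sort _ => ∅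
  | pi A B => A.names ∪ B.names
  | lam t => t.names
  | app t u => t.names ∪ u.names
  | piC A B => A.names ∪ B.names
  | lamC t => t.names
  | appC t l => t.names ∪ l.names

/-- The level has no de Bruijn index: all its variables are free level variables. -/
def Level.IdxFree : Level → Prop
  | name _ => True
  | idx _ => False
  | zero => True
  | succ l => l.IdxFree
  | sup l l' => l.IdxFree ∧ l'.IdxFree

/-- A level substitution `θ`: a substitution with finite domain, mapping free level variables to
levels over free level variables. -/
structure LevelSubst : Type where
  toFun : ℕ → Level
  finite : {i | toFun i ≠ .name i}.Finite
  idxFree : ∀ i, (toFun i).IdxFree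

/-- `l[θ]`. -/
def Level.lsubst (θ : LevelSubst) : Level → Level
  | name i => θ.toFun i
  | idx n => idx n
  | zero => zero
  | succ l => succ (l.lsubst θ)
  | sup l l' => sup (l.lsubst θ) (l'.lsubst θ)

/-- `t[θ]`.  No shift is needed under binders, since the levels `θ i` contain no index. -/
def Term.lsubst (θ : LevelSubst) : Term → Term
  | var n => var n
  | const c => const c
  | sort s => sort s
  | pi A B => pi (A.lsubst θ) (B.lsubst θ)
  | lam t => lam (t.lsubst θ)
  | app t u => app (t.lsubst θ) (u.lsubst θ)
  | piC A B => piC (A.lsubst θ) (B.lsubst θ)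
  | lamC t => lamC (t.lsubst θ)
  | appC t l => appC (t.lsubst θ) (l.lsubst θ)

/-! ### The theory `UPP` and local signatures -/

/-- The type of levels. -/
def tLvl : Term := .const (.glob .Lvl)

/-- `Ty l`. -/
def tTy (l : Level) : Term := .appC (.const (.glob .Ty)) l

/-- `Tm l A`. -/
def tTm (l : Level) (A : Term) : Term := .app (.appC (.const (.glob .Tm)) l) A

/-- `U l`. -/
def tU (l : Level) : Term := .appC (.const (.glob .U)) l

/-- `Π l l' A B`. -/
def tPi (l l' : Level) (A B : Term) : Term :=
  .app (.app (.appC (.appC (.const (.glob .Pi)) l) l') A) B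

/-- `λ l l' A B t`. -/
def tLam (l l' : Level) (A B t : Term) : Term :=
  .app (.app (.app (.appC (.appC (.const (.glob .Lam)) l) l') A) B) t

/-- `@ l l' A B t u`. -/
def tApp (l l' : Level) (A B t u : Term) : Term :=
  .app (.app (.app (.app (.appC (.appC (.const (.glob .App)) l) l') A) B) t) u

/-- The types of the global constants. -/
def Glob.type : Glob → Term
  -- `Lvl : Type`
  | Lvl => .sort .type
  -- `Ty : (l : Lvl) → Type`
  | Ty => .piC tLvl (.sort .type)
  -- `Tm : (l : Lvl) → Ty l → Type`
  | Tm => .piC tLvl (.pi (tTy (.idx 0)) (.sort .type))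
  -- `U : (l : Lvl) → Ty (S l)`
  | U => .piC tLvl (tTy (.succ (.idx 0)))
  -- `Π : (l l' : Lvl) → (A : Ty l) → (B : Tm l A → Ty l') → Ty (l ⊔ l')`
  | Pi => .piC tLvl (.piC tLvl (.pi (tTy (.idx 1))
      (.pi (.pi (tTm (.idx 1) (.var 0)) (tTy (.idx 0)))
        (tTy (.sup (.idx 1) (.idx 0))))))
  -- `λ : (l l' : Lvl) → (A : Ty l) → (B : Tm l A → Ty l') →`
  -- `  ((x : Tm l A) → Tm l' (B x)) → Tm (l ⊔ l') (Π l l' A B)`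
  | Lam => .piC tLvl (.piC tLvl (.pi (tTy (.idx 1))
      (.pi (.pi (tTm (.idx 1) (.var 0)) (tTy (.idx 0)))
        (.pi (.pi (tTm (.idx 1) (.var 1)) (tTm (.idx 0) (.app (.var 1) (.var 0))))
          (tTm (.sup (.idx 1) (.idx 0)) (tPi (.idx 1) (.idx 0) (.var 2) (.var 1)))))))
  -- `@ : (l l' : Lvl) → (A : Ty l) → (B : Tm l A → Ty l') →`
  -- `  (t : Tm (l ⊔ l') (Π l l' A B)) → (u : Tm l A) → Tm l' (B u)`
  | App => .piC tLvl (.piC tLvl (.pi (tTy (.idx 1))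
      (.pi (.pi (tTm (.idx 1) (.var 0)) (tTy (.idx 0)))
        (.pi (tTm (.sup (.idx 1) (.idx 0)) (tPi (.idx 1) (.idx 0) (.var 1) (.var 0)))
          (.pi (tTm (.idx 1) (.var 2))
            (tTm (.idx 0) (.app (.var 2) (.var 0))))))))

/-- An entry `c : A` (no body) or `c : A := t` of a local signature. -/
structure SigEntry : Type where
  name : ℕ
  type : Term
  body : Option Term

/-- A local signature, the most recent entry first. -/
abbrev LocalSig : Type := List SigEntry

/-- `c : A` or `c : A := t` is an entry of the signature of `UPP` extended by `Φ`. -/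
inductive Declares (Φ : LocalSig) : Const → Term → Prop
  | glob (g : Glob) : Declares Φ (.glob g) g.type
  | loc {e : SigEntry} : e ∈ Φ → Declares Φ (.loc e.name) e.type

/-! ### Rewriting and conversion -/

/-- The equational theory of levels: the congruence generated by the substitution instances of the
equations of `UPP`. -/
inductive LevelEq : Level → Level → Prop
  | refl (l) : LevelEq l l
  | symm {l l'} : LevelEq l l' → LevelEq l' l
  | trans {l l' l''} : LevelEq l l' → LevelEq l' l'' → LevelEq l l''
  | succ_congr {l l'} : LevelEq l l' → LevelEq (.succ l) (.succ l')
  | sup_congr {l₁ l₁' l₂ l₂'} : LevelEq l₁ l₁' → LevelEq l₂ l₂' →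
      LevelEq (.sup l₁ l₂) (.sup l₁' l₂')
  | assoc (l₁ l₂ l₃) : LevelEq (.sup l₁ (.sup l₂ l₃)) (.sup (.sup l₁ l₂) l₃)
  | comm (l₁ l₂) : LevelEq (.sup l₁ l₂) (.sup l₂ l₁)
  | succ_sup (l₁ l₂) : LevelEq (.succ (.sup l₁ l₂)) (.sup (.succ l₁) (.succ l₂))
  | sup_succ (l) : LevelEq (.sup l (.succ l)) (.succ l)
  | sup_zero (l) : LevelEq (.sup l .zero) l
  | sup_idem (l) : LevelEq (.sup l l) l

/-- The relation `≃` on terms: the two terms are equal up to the equational theory of the levels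
that occur in them. -/
inductive TermEq : Term → Term → Prop
  | var (n) : TermEq (.var n) (.var n)
  | const (c) : TermEq (.const c) (.const c)
  | sort (s) : TermEq (.sort s) (.sort s)
  | pi {A A' B B'} : TermEq A A' → TermEq B B' → TermEq (.pi A B) (.pi A' B')
  | lam {t t'} : TermEq t t' → TermEq (.lam t) (.lam t')
  | app {t t' u u'} : TermEq t t' → TermEq u u' → TermEq (.app t u) (.app t' u')
  | piC {A A' B B'} : TermEq A A' → TermEq B B' → TermEq (.piC A B) (.piC A' B')
  | lamC {t t'} : TermEq t t' → TermEq (.lamC t) (.lamC t')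
  | appC {t t' l l'} : TermEq t t' → LevelEq l l' → TermEq (.appC t l) (.appC t' l')

/-- `Contracts Φ u v`: the term `u` is an instance of the left-hand side of a rule among `β`, `βc`,
the `δ` rules of `Φ` and the rewrite rules of `UPP`, and `v` is the corresponding instance of its
right-hand side. -/
inductive Contracts (Φ : LocalSig) : Term → Term → Prop
  | beta (t u) : Contracts Φ (.app (.lam t) u) (t.inst u)
  | betaC (t l) : Contracts Φ (.appC (.lamC t) l) (t.instC l)
  | delta {e : SigEntry} {t : Term} : e ∈ Φ → e.body = some t →
      Contracts Φ (.const (.loc e.name)) t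
  | tmU (l' l) : Contracts Φ (tTm l' (tU l)) (tTy l)
  | appLam (l l' l'' l''' A B A' B' t u) :
      Contracts Φ (tApp l l' A B (tLam l'' l''' A' B' t) u) (.app t u)

/-- One-step reduction `⟶`: the closure by context of `Contracts Φ`. -/
inductive Step (Φ : LocalSig) : Term → Term → Prop
  | root {t t'} : Contracts Φ t t' → Step Φ t t'
  | pi_dom {A A'} (B) : Step Φ A A' → Step Φ (.pi A B) (.pi A' B)
  | pi_cod {B B'} (A) : Step Φ B B' → Step Φ (.pi A B) (.pi A B')
  | lam {t t'} : Step Φ t t' → Step Φ (.lam t) (.lam t')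
  | app_fun {t t'} (u) : Step Φ t t' → Step Φ (.app t u) (.app t' u)
  | app_arg {u u'} (t) : Step Φ u u' → Step Φ (.app t u) (.app t u')
  | piC_dom {A A'} (B) : Step Φ A A' → Step Φ (.piC A B) (.piC A' B)
  | piC_cod {B B'} (A) : Step Φ B B' → Step Φ (.piC A B) (.piC A B')
  | lamC {t t'} : Step Φ t t' → Step Φ (.lamC t) (.lamC t')
  | appC {t t'} (l) : Step Φ t t' → Step Φ (.appC t l) (.appC t' l)

/-- Reduction in any number of steps. -/
def Red (Φ : LocalSig) : Term → Term → Prop := Relation.ReflTransGen (Step Φ)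

/-- Conversion `≡`: the equivalence relation generated by `⟶` and `≃`. -/
def Conv (Φ : LocalSig) : Term → Term → Prop :=
  Relation.EqvGen (fun t u => Step Φ t u ∨ TermEq t u)

/-! ### Typing -/

/-- A context entry: `reg A` stands for `x : A` and `conf A` for `i : A`. -/
inductive CtxEntry : Type
  | reg (A : Term)
  | conf (A : Term)

/-- Contexts, the most recent entry first. -/
abbrev Ctx : Type := List CtxEntry

/-- `x : A ∈ Γ`, where `x` is the regular variable of index `n`. -/
inductive Ctx.HasVar : Ctx → ℕ → Term → Prop
  | here (Γ A) : HasVar (.reg A :: Γ) 0 A.shift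
  | reg {Γ n A} (B) : HasVar Γ n A → HasVar (.reg B :: Γ) (n + 1) A.shift
  | conf {Γ n A} (B) : HasVar Γ n A → HasVar (.conf B :: Γ) n A.shiftC

/-- `i : A ∈ Γ`, where `i` is the confined variable of index `n`. -/
inductive Ctx.HasVarC : Ctx → ℕ → Term → Prop
  | here (Γ A) : HasVarC (.conf A :: Γ) 0 A.shiftC
  | reg {Γ n A} (B) : HasVarC Γ n A → HasVarC (.reg B :: Γ) n A.shift
  | conf {Γ n A} (B) : HasVarC Γ n A → HasVarC (.conf B :: Γ) (n + 1) A.shiftC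

/-- `Γ[θ]`. -/
def Ctx.lsubst (θ : LevelSubst) : Ctx → Ctx
  | [] => []
  | .reg A :: Γ => .reg (A.lsubst θ) :: Ctx.lsubst θ Γ
  | .conf A :: Γ => .conf (A.lsubst θ) :: Ctx.lsubst θ Γ

/-- The judgment forms `Γ ⊢`, `Γ ⊢ t : A` and `Γ ⊢ l : A`. -/
inductive Judgment : Type
  | wf
  | term (t A : Term)
  | level (l : Level) (A : Term)

/-- `Der Φ Ξ Γ J` is the Dedukti judgment `Ξ, Γ ⊢ J` in the theory `UPP` extended by `Φ`, where the
finite set `Ξ` stands for the context with an entry `j : Lvl` for every `j ∈ Ξ`. -/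
inductive Der (Φ : LocalSig) (Ξ : Finset ℕ) : Ctx → Judgment → Prop
  | emptyCtx : Der Φ Ξ [] .wf
  | extCtx {Γ A} : Der Φ Ξ Γ (.term A (.sort .type)) → Der Φ Ξ (.reg A :: Γ) .wf
  | extCtxC {Γ A} : Der Φ Ξ Γ (.term A (.sort .type)) → Der Φ Ξ (.conf A :: Γ) .wf
  | sort {Γ} : Der Φ Ξ Γ .wf → Der Φ Ξ Γ (.term (.sort .type) (.sort .kind))
  | var {Γ n A} : Ctx.HasVar Γ n A → Der Φ Ξ Γ .wf → Der Φ Ξ Γ (.term (.var n) A)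
  -- the confined variables of `Γ`
  | varC {Γ n A} : Ctx.HasVarC Γ n A → Der Φ Ξ Γ .wf → Der Φ Ξ Γ (.level (.idx n) A)
  -- the confined variables of `Ξ`
  | varΞ {Γ j} : j ∈ Ξ → Der Φ Ξ Γ .wf → Der Φ Ξ Γ (.level (.name j) tLvl)
  | cons {Γ c A} : Declares Φ c A → Der Φ Ξ Γ .wf → Der Φ Ξ Γ (.term (.const c) A)
  -- the rule for confined constants, for `0 : () → Lvl`, `S : (i : Lvl) → Lvl` and
  -- `⊔ : (i : Lvl, i' : Lvl) → Lvl`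
  | zero {Γ} : Der Φ Ξ Γ .wf → Der Φ Ξ Γ (.level .zero tLvl)
  | succ {Γ l} : Der Φ Ξ Γ (.level l tLvl) → Der Φ Ξ Γ (.level (.succ l) tLvl)
  | sup {Γ l l'} : Der Φ Ξ Γ (.level l tLvl) → Der Φ Ξ Γ (.level l' tLvl) →
      Der Φ Ξ Γ (.level (.sup l l') tLvl)
  | conv {Γ t A B s} : Conv Φ A B → Der Φ Ξ Γ (.term t A) → Der Φ Ξ Γ (.term B (.sort s)) →
      Der Φ Ξ Γ (.term t B)
  | convC {Γ l A B} : Conv Φ A B → Der Φ Ξ Γ (.level l A) →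
      Der Φ Ξ Γ (.term B (.sort .type)) → Der Φ Ξ Γ (.level l B)
  | arrow {Γ A B s} : Der Φ Ξ Γ (.term A (.sort .type)) →
      Der Φ Ξ (.reg A :: Γ) (.term B (.sort s)) → Der Φ Ξ Γ (.term (.pi A B) (.sort s))
  | arrowC {Γ A B s} : Der Φ Ξ Γ (.term A (.sort .type)) →
      Der Φ Ξ (.conf A :: Γ) (.term B (.sort s)) → Der Φ Ξ Γ (.term (.piC A B) (.sort s))
  | abs {Γ A B t s} : Der Φ Ξ Γ (.term A (.sort .type)) →
      Der Φ Ξ (.reg A :: Γ) (.term B (.sort s)) → Der Φ Ξ (.reg A :: Γ) (.term t B) →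
      Der Φ Ξ Γ (.term (.lam t) (.pi A B))
  | absC {Γ A B t s} : Der Φ Ξ Γ (.term A (.sort .type)) →
      Der Φ Ξ (.conf A :: Γ) (.term B (.sort s)) → Der Φ Ξ (.conf A :: Γ) (.term t B) →
      Der Φ Ξ Γ (.term (.lamC t) (.piC A B))
  | app {Γ t u A B} : Der Φ Ξ Γ (.term t (.pi A B)) → Der Φ Ξ Γ (.term u A) →
      Der Φ Ξ Γ (.term (.app t u) (B.inst u))
  | appC {Γ t l A B} : Der Φ Ξ Γ (.term t (.piC A B)) → Der Φ Ξ Γ (.level l A) →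
      Der Φ Ξ Γ (.term (.appC t l) (B.instC l))

/-- `Φ` is well-formed in `UPP`: every entry declares a new constant and is valid in the theory
`UPP` extended by the preceding entries. -/
inductive LocalSig.WellFormed : LocalSig → Prop
  | nil : WellFormed []
  | decl {Φ : LocalSig} {c : ℕ} {A : Term} {s : Srt} : WellFormed Φ → (∀ e ∈ Φ, e.name ≠ c) →
      Der Φ ∅ [] (.term A (.sort s)) → WellFormed (⟨c, A, none⟩ :: Φ)
  | defn {Φ : LocalSig} {c : ℕ} {A t : Term} : WellFormed Φ → (∀ e ∈ Φ, e.name ≠ c) →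
      Der Φ ∅ [] (.term t A) → WellFormed (⟨c, A, some t⟩ :: Φ)

/-! ### Constraints and typing under constraints -/

/-- A level constraint, i.e. an equation `l ≐ l'` between levels. -/
abbrev Constraint : Type := Level × Level

/-- `θ ⊨ C`. -/
def LevelSubst.Satisfies (θ : LevelSubst) (C : Set Constraint) : Prop :=
  ∀ e ∈ C, LevelEq (e.1.lsubst θ) (e.2.lsubst θ)

/-- The context `Ξ_θ`, where `V` is the set of the level variables inserted in the schematic terms:
it has an entry `j : Lvl` for every level variable `j` that occurs in `i[θ]` for some `i ∈ V`. -/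
def levelCtx (V : Finset ℕ) (θ : LevelSubst) : Finset ℕ :=
  V.biUnion fun i => (θ.toFun i).names

/-- `Γ ⊢_C`. -/
def WfUnder (Φ : LocalSig) (V : Finset ℕ) (C : Set Constraint) (Γ : Ctx) : Prop :=
  ∀ θ : LevelSubst, θ.Satisfies C → Der Φ (levelCtx V θ) (Γ.lsubst θ) .wf

/-- `Γ ⊢_C t : A`. -/
def TypedUnder (Φ : LocalSig) (V : Finset ℕ) (C : Set Constraint) (Γ : Ctx) (t A : Term) : Prop :=
  ∀ θ : LevelSubst, θ.Satisfies C →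
    Der Φ (levelCtx V θ) (Γ.lsubst θ) (.term (t.lsubst θ) (A.lsubst θ))

/-! ### The bidirectional system -/

/-- An argument of an application: a regular or a confined term. -/
inductive Arg : Type
  | reg (u : Term)
  | conf (l : Level)

/-- `t a₁ … aₖ`. -/
def Term.appArgs : Term → List Arg → Term
  | t, [] => t
  | t, .reg u :: as => (Term.app t u).appArgs as
  | t, .conf l :: as => (Term.appC t l).appArgs as

/-- Weak-head normal forms: if `u` reduces to `u' a₁ … aₖ`, then `u'` is not an instance of the
left-hand side of a rule. -/
def IsWhnf (Φ : LocalSig) (u : Term) : Prop :=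
  ∀ u' as, Red Φ u (Term.appArgs u' as) → ¬ ∃ v, Contracts Φ u' v

/-- `t ⟶ʷʰ u`: the term `t` reduces to the weak-head normal form `u`. -/
def RedWh (Φ : LocalSig) (t u : Term) : Prop := Red Φ t u ∧ IsWhnf Φ u

/-- The two constrained conversion judgments `A ≡ B ↓ C` and `A ≡_whnf B ↓ C`. -/
inductive ConvMode : Type
  | any | whnf

/-- The rules of the constrained conversion judgments. -/
inductive ConvC (Φ : LocalSig) : ConvMode → Term → Term → Set Constraint → Prop
  | reduce {A A' B B' C} : RedWh Φ A A' → RedWh Φ B B' → ConvC Φ .whnf A' B' C →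
      ConvC Φ .any A B C
  | var (n) : ConvC Φ .whnf (.var n) (.var n) ∅
  | const (c) : ConvC Φ .whnf (.const c) (.const c) ∅
  | sort (s) : ConvC Φ .whnf (.sort s) (.sort s) ∅
  | lam {t t' C} : ConvC Φ .any t t' C → ConvC Φ .whnf (.lam t) (.lam t') C
  | pi {A A' B B' C₁ C₂} : ConvC Φ .any A A' C₁ → ConvC Φ .any B B' C₂ →
      ConvC Φ .whnf (.pi A B) (.pi A' B') (C₁ ∪ C₂)
  | app {t t' u u' C₁ C₂} : ConvC Φ .whnf t t' C₁ → ConvC Φ .any u u' C₂ →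
      ConvC Φ .whnf (.app t u) (.app t' u') (C₁ ∪ C₂)
  | appC {t t' C} (l l') : ConvC Φ .whnf t t' C →
      ConvC Φ .whnf (.appC t l) (.appC t' l') (C ∪ {(l, l')})

/-- `(j₁ … jₖ : Lvl) → B`. -/
def piLvls : ℕ → Term → Term
  | 0, B => B
  | k + 1, B => .piC tLvl (piLvls k B)

/-- `t i₁ … iₖ` for free level variables `i₁, …, iₖ`. -/
def Term.appNames (t : Term) (is : List ℕ) : Term :=
  is.foldl (fun t i => .appC t (.name i)) t

/-- `B[j₁ ↦ i₁, …, jₖ ↦ iₖ]`, where `j₁, …, jₖ` are the last confined variables of the scope of `B`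
(`jₖ` being the last one) and `i₁, …, iₖ` are free level variables. -/
def Term.instNames (B : Term) (is : List ℕ) : Term :=
  is.foldr (fun i B => B.instC (.name i)) B

/-- The two modes of the bidirectional system. -/
inductive Mode : Type
  | check | infer

/-- The bidirectional system: `Bidi Φ .check Γ D t A C` is `Γ ↑ D ⊢ t ⇐ A ↓ C`, and
`Bidi Φ .infer Γ D t A C` is `Γ ↑ D ⊢ t ⇒ A ↓ C`. -/
inductive Bidi (Φ : LocalSig) :
    Mode → Ctx → Set Constraint → Term → Term → Set Constraint → Prop
  | switch {Γ D t A B C₁ C₂} : Bidi Φ .infer Γ D t A C₁ → ConvC Φ .any A B C₂ →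
      Bidi Φ .check Γ D t B (C₁ ∪ C₂)
  | abs {Γ D t A B T C} : RedWh Φ T (.pi A B) → Bidi Φ .check (.reg A :: Γ) D t B C →
      Bidi Φ .check Γ D (.lam t) T C
  | var {Γ n A} (D) : Ctx.HasVar Γ n A → Bidi Φ .infer Γ D (.var n) A ∅
  | cons {c B} (Γ D) (is : List ℕ) : Declares Φ c (piLvls is.length B) →
      Bidi Φ .infer Γ D (Term.appNames (.const c) is) (B.instNames is) ∅
  | sort (Γ D) : Bidi Φ .infer Γ D (.sort .type) (.sort .kind) ∅
  | pi {Γ D A B T s C₁ C₂} : Bidi Φ .check Γ D A (.sort .type) C₁ →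
      Bidi Φ .infer (.reg A :: Γ) (D ∪ C₁) B T C₂ → RedWh Φ T (.sort s) →
      Bidi Φ .infer Γ D (.pi A B) (.sort s) (C₁ ∪ C₂)
  | app {Γ D t u T A B C₁ C₂} : Bidi Φ .infer Γ D t T C₁ → RedWh Φ T (.pi A B) →
      Bidi Φ .check Γ (D ∪ C₁) u A C₂ →
      Bidi Φ .infer Γ D (.app t u) (B.inst u) (C₁ ∪ C₂)

end UPP

/-! Fix one level substitution θ that satisfies the computed constraints. Under θ each constraint
becomes a level equation that holds, so the claim is about ordinary typing. It is proved in
`Bidi.sound` by induction on the bidirectional derivation: a checked term has its type as soon as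
that type, under θ, has a sort; an inferred typing holds as soon as the context, under θ, is
well-formed. The constraints `D` matter only in making these formation hypotheses available at θ.
Level variables inserted in the term lie in `V`, so their images are levels over Ξ_θ, hence of type
`Lvl`.

The induction rests on two facts. Constrained conversion of `A` and `B` yields `A[θ] ≡ B[θ]`
(`ConvC.conv`), because no rule inspects a level and reduction is therefore stable under θ. Moreover
the system reduces types until a product or a sort appears, so reducts of well-formed types must be
well-formed: this is subject reduction (`Der.step`), used with validity (`Der.type_typed`), by which
the type of a term is `Kind` or has a sort.

Subject reduction needs products to be injective modulo `≡`, which comes from a Church–Rosser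
property. The level equations are not oriented: `Par` contracts redexes in parallel and may at the
same time replace levels by equal ones, so it contains both generators of `≡`. The rules are
left-linear, do not overlap and match levels by variables only, so each term has a complete
development (`Par.triangle`).

The rule for `@` does not compare the annotations of `@` with those of `λ`. On typed terms they
agree anyway: `Tm l (Π …)` is never a redex at its head, so conversion between two such types
equates the arguments of the two `Π` (`Conv.tTm_tPi_inj`, `Der.contract_appLam`). -/

namespace UPP

/-! ### The substitution calculus -/

namespace Level

theorem rename_rename (ρ ρ' : ℕ → ℕ) (l : Level) :
    (l.rename ρ).rename ρ' = l.rename (fun n => ρ' (ρ n)) := by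
  induction l <;> simp_all [rename]

theorem subst_rename (ρ : ℕ → ℕ) (τ : ℕ → Level) (l : Level) :
    (l.rename ρ).subst τ = l.subst (fun n => τ (ρ n)) := by
  induction l <;> simp_all [rename, subst]

theorem rename_subst (τ : ℕ → Level) (ρ : ℕ → ℕ) (l : Level) :
    (l.subst τ).rename ρ = l.subst (fun n => (τ n).rename ρ) := by
  induction l <;> simp_all [rename, subst]

theorem subst_subst (τ τ' : ℕ → Level) (l : Level) :
    (l.subst τ).subst τ' = l.subst (fun n => (τ n).subst τ') := by
  induction l <;> simp_all [subst]

theorem subst_idx (l : Level) : l.subst idx = l := by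
  induction l <;> simp_all [subst]

theorem rename_eq_subst (ρ : ℕ → ℕ) (l : Level) : l.rename ρ = l.subst (fun n => idx (ρ n)) := by
  induction l <;> simp_all [rename, subst]

theorem IdxFree.subst_eq {l : Level} (h : l.IdxFree) (τ : ℕ → Level) : l.subst τ = l := by
  induction l <;> simp_all [subst, IdxFree]

/-- An index substitution performed after θ finds nothing to act on in the levels `θ i`, which have
no index. This is what lets θ cross binders without shifts. -/
theorem lsubst_subst (θ : LevelSubst) (τ : ℕ → Level) (l : Level) :
    (l.subst τ).lsubst θ = (l.lsubst θ).subst (fun n => (τ n).lsubst θ) := by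
  induction l <;> simp_all [subst, lsubst, (θ.idxFree _).subst_eq]

end Level

theorem upRen_comp (ρ ρ' : ℕ → ℕ) :
    (fun n => upRen ρ' (upRen ρ n)) = upRen (fun n => ρ' (ρ n)) := by
  funext n; cases n <;> rfl

theorem upSub_upRen (ρ : ℕ → ℕ) (σ : ℕ → Term) :
    (fun n => upSub σ (upRen ρ n)) = upSub (fun n => σ (ρ n)) := by
  funext n; cases n <;> rfl

theorem upSubC_upRen (ξ : ℕ → ℕ) (τ : ℕ → Level) :
    (fun n => upSubC τ (upRen ξ n)) = upSubC (fun n => τ (ξ n)) := by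
  funext n; cases n <;> rfl

theorem upSub_var : upSub .var = .var := by
  funext n; cases n <;> rfl

theorem upSubC_idx : upSubC .idx = .idx := by
  funext n; cases n <;> rfl

theorem upSub_var_ren (ρ : ℕ → ℕ) : (fun n => Term.var (upRen ρ n)) = upSub (fun n => .var (ρ n)) := by
  funext n; cases n <;> rfl

theorem upSubC_idx_ren (ξ : ℕ → ℕ) :
    (fun n => Level.idx (upRen ξ n)) = upSubC (fun n => .idx (ξ n)) := by
  funext n; cases n <;> rfl

theorem upSubC_rename (τ : ℕ → Level) (ξ : ℕ → ℕ) :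
    (fun n => (upSubC τ n).rename (upRen ξ)) = upSubC (fun n => (τ n).rename ξ) := by
  funext n
  cases n
  · rfl
  · simp only [upSubC, Level.rename_rename]; rfl

theorem upSubC_subst (τ τ' : ℕ → Level) :
    (fun n => (upSubC τ n).subst (upSubC τ')) = upSubC (fun n => (τ n).subst τ') := by
  funext n
  cases n
  · rfl
  · simp only [upSubC, Level.subst_rename, Level.rename_subst]

namespace Term

theorem rename_rename (t : Term) (ρ ξ ρ' ξ' : ℕ → ℕ) :
    (t.rename ρ ξ).rename ρ' ξ' = t.rename (fun n => ρ' (ρ n)) (fun n => ξ' (ξ n)) := by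
  induction t generalizing ρ ξ ρ' ξ' <;>
    simp_all [rename, upRen_comp, Level.rename_rename]

theorem subst_rename (t : Term) (ρ ξ : ℕ → ℕ) (σ : ℕ → Term) (τ : ℕ → Level) :
    (t.rename ρ ξ).subst σ τ = t.subst (fun n => σ (ρ n)) (fun n => τ (ξ n)) := by
  induction t generalizing ρ ξ σ τ <;>
    simp_all [rename, subst, upSub_upRen, upSubC_upRen, Level.subst_rename]

theorem rename_shift (t : Term) (ρ ξ : ℕ → ℕ) :
    t.shift.rename (upRen ρ) ξ = (t.rename ρ ξ).shift := by
  simp only [shift, rename_rename]; rfl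

theorem rename_shiftC (t : Term) (ρ ξ : ℕ → ℕ) :
    t.shiftC.rename ρ (upRen ξ) = (t.rename ρ ξ).shiftC := by
  simp only [shiftC, rename_rename]; rfl

theorem upSub_rename (σ : ℕ → Term) (ρ ξ : ℕ → ℕ) :
    (fun n => (upSub σ n).rename (upRen ρ) ξ) = upSub (fun n => (σ n).rename ρ ξ) := by
  funext n
  cases n
  · rfl
  · exact rename_shift _ _ _

theorem rename_subst (t : Term) (σ : ℕ → Term) (τ : ℕ → Level) (ρ ξ : ℕ → ℕ) :
    (t.subst σ τ).rename ρ ξ =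
      t.subst (fun n => (σ n).rename ρ ξ) (fun n => (τ n).rename ξ) := by
  induction t generalizing ρ ξ σ τ <;>
    simp_all [rename, subst, upSub_rename, upSubC_rename, Level.rename_subst, rename_shiftC]

theorem subst_shift (t : Term) (σ : ℕ → Term) (τ : ℕ → Level) :
    t.shift.subst (upSub σ) τ = (t.subst σ τ).shift := by
  simp only [shift, rename_subst, subst_rename, Level.rename_eq_subst]
  simp only [upSub, shift, id, Level.subst_idx]

theorem subst_shiftC (t : Term) (σ : ℕ → Term) (τ : ℕ → Level) :
    t.shiftC.subst (fun n => (σ n).shiftC) (upSubC τ) = (t.subst σ τ).shiftC := by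
  simp only [shiftC, rename_subst, subst_rename, upSubC, id]

theorem upSub_subst (σ σ' : ℕ → Term) (τ' : ℕ → Level) :
    (fun n => (upSub σ n).subst (upSub σ') τ') = upSub (fun n => (σ n).subst σ' τ') := by
  funext n
  cases n
  · rfl
  · exact subst_shift _ _ _

/-- Last of four composition laws whose order is forced: under a binder the substituted terms are
shifted, a shift is a renaming, and commuting it with a substitution uses the laws that mix the two.
-/
theorem subst_subst (t : Term) (σ : ℕ → Term) (τ : ℕ → Level) (σ' : ℕ → Term) (τ' : ℕ → Level) :
    (t.subst σ τ).subst σ' τ' =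
      t.subst (fun n => (σ n).subst σ' τ') (fun n => (τ n).subst τ') := by
  induction t generalizing σ τ σ' τ' <;>
    simp_all [subst, upSub_subst, upSubC_subst, Level.subst_subst, subst_shiftC]

theorem subst_var (t : Term) : t.subst .var .idx = t := by
  induction t <;> simp_all [subst, upSub_var, upSubC_idx, Level.subst_idx]
  -- What remains are the confined binders, where `fun n => (var n).shiftC` is `var` by definition.
  all_goals exact ‹_›

theorem rename_eq_subst (t : Term) (ρ ξ : ℕ → ℕ) :
    t.rename ρ ξ = t.subst (fun n => .var (ρ n)) (fun n => .idx (ξ n)) := by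
  rw [← subst_var (t.rename ρ ξ), subst_rename]

theorem subst_inst (B u : Term) (σ : ℕ → Term) (τ : ℕ → Level) :
    (B.inst u).subst σ τ = (B.subst (upSub σ) τ).inst (u.subst σ τ) := by
  simp only [inst, subst_subst]
  congr 1
  · funext n
    cases n
    · rfl
    · simp only [upSub, shift, subst_rename, subst]
      exact (subst_var _).symm
  · funext n; simp [Level.subst_idx, Level.subst]

theorem subst_instC (B : Term) (l : Level) (σ : ℕ → Term) (τ : ℕ → Level) :
    (B.instC l).subst σ τ =
      (B.subst (fun n => (σ n).shiftC) (upSubC τ)).instC (l.subst τ) := by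
  simp only [instC, subst_subst]
  congr 1
  · funext n
    simp only [shiftC, subst_rename, subst]
    exact (subst_var _).symm
  · funext n
    cases n
    · rfl
    · simp only [upSubC, Level.subst_rename, Level.subst]
      exact (Level.subst_idx _).symm

theorem rename_inst (B u : Term) (ρ ξ : ℕ → ℕ) :
    (B.inst u).rename ρ ξ = (B.rename (upRen ρ) ξ).inst (u.rename ρ ξ) := by
  simp only [rename_eq_subst, subst_inst, upSub_var_ren]

theorem rename_instC (B : Term) (l : Level) (ρ ξ : ℕ → ℕ) :
    (B.instC l).rename ρ ξ = (B.rename ρ (upRen ξ)).instC (l.rename ξ) := by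
  simp only [rename_eq_subst, subst_instC, upSubC_idx_ren, Level.rename_eq_subst]
  rfl

theorem lsubst_rename (θ : LevelSubst) (t : Term) (ρ ξ : ℕ → ℕ) :
    (t.rename ρ ξ).lsubst θ = (t.lsubst θ).rename ρ ξ := by
  induction t generalizing ρ ξ <;>
    simp_all [rename, lsubst, Level.rename_eq_subst, Level.lsubst_subst, Level.lsubst]

theorem upSub_lsubst (θ : LevelSubst) (σ : ℕ → Term) :
    (fun n => (upSub σ n).lsubst θ) = upSub (fun n => (σ n).lsubst θ) := by
  funext n
  cases n
  · rfl
  · exact lsubst_rename _ _ _ _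

theorem upSubC_lsubst (θ : LevelSubst) (τ : ℕ → Level) :
    (fun n => (upSubC τ n).lsubst θ) = upSubC (fun n => (τ n).lsubst θ) := by
  funext n
  cases n
  · rfl
  · simp [upSubC, Level.rename_eq_subst, Level.lsubst_subst, Level.lsubst]

theorem lsubst_subst (θ : LevelSubst) (t : Term) (σ : ℕ → Term) (τ : ℕ → Level) :
    (t.subst σ τ).lsubst θ =
      (t.lsubst θ).subst (fun n => (σ n).lsubst θ) (fun n => (τ n).lsubst θ) := by
  induction t generalizing σ τ <;>
    simp_all [subst, lsubst, upSub_lsubst, upSubC_lsubst, Level.lsubst_subst, shiftC, lsubst_rename]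

theorem lsubst_inst (θ : LevelSubst) (B u : Term) :
    (B.inst u).lsubst θ = (B.lsubst θ).inst (u.lsubst θ) := by
  simp only [inst, lsubst_subst]
  congr 1
  funext n; cases n <;> rfl

theorem lsubst_instC (θ : LevelSubst) (B : Term) (l : Level) :
    (B.instC l).lsubst θ = (B.lsubst θ).instC (l.lsubst θ) := by
  simp only [instC, lsubst_subst]
  congr 1
  funext n; cases n <;> rfl

end Term

/-! ### Confluence modulo the equational theory of levels -/

/-- Change one side at a time: a fixed level respects equality of the substitutions, and the
equations are closed under a fixed substitution. -/
theorem LevelEq.subst {l l' : Level} (h : LevelEq l l') {τ τ' : ℕ → Level}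
    (hτ : ∀ n, LevelEq (τ n) (τ' n)) : LevelEq (l.subst τ) (l'.subst τ') := by
  have key : ∀ (l : Level) {τ τ' : ℕ → Level}, (∀ n, LevelEq (τ n) (τ' n)) →
      LevelEq (l.subst τ) (l.subst τ') := by
    intro l τ τ' hτ
    induction l with
    | name i => exact .refl _
    | idx n => exact hτ n
    | zero => exact .refl _
    | succ l ih => exact .succ_congr ih
    | sup l l' ih ih' => exact .sup_congr ih ih'
  have key' : LevelEq (l.subst τ) (l'.subst τ) := by
    clear hτ
    induction h with
    | refl l => exact .refl _
    | symm _ ih => exact ih.symm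
    | trans _ _ ih ih' => exact ih.trans ih'
    | succ_congr _ ih => exact ih.succ_congr
    | sup_congr _ _ ih ih' => exact ih.sup_congr ih'
    | assoc l₁ l₂ l₃ => exact .assoc _ _ _
    | comm l₁ l₂ => exact .comm _ _
    | succ_sup l₁ l₂ => exact .succ_sup _ _
    | sup_succ l => exact .sup_succ _
    | sup_zero l => exact .sup_zero _
    | sup_idem l => exact .sup_idem _
  exact key'.trans (key l' hτ)

theorem LevelEq.rename {l l' : Level} (h : LevelEq l l') (ξ : ℕ → ℕ) :
    LevelEq (l.rename ξ) (l'.rename ξ) := by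
  simp only [Level.rename_eq_subst]
  exact h.subst fun _ => .refl _

theorem LevelEq.upSubC {τ τ' : ℕ → Level} (hτ : ∀ n, LevelEq (τ n) (τ' n)) (n : ℕ) :
    LevelEq (upSubC τ n) (upSubC τ' n) := by
  cases n
  · exact .refl _
  · exact (hτ _).rename _

/-- A term without free variables of any kind. -/
structure Term.Closed (t : Term) : Prop where
  subst : ∀ σ τ, t.subst σ τ = t
  lsubst : ∀ θ, t.lsubst θ = t

theorem Term.Closed.rename {t : Term} (h : t.Closed) (ρ ξ : ℕ → ℕ) : t.rename ρ ξ = t := by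
  rw [Term.rename_eq_subst, h.subst]

theorem Glob.type_closed (g : Glob) : g.type.Closed := by
  cases g <;> exact ⟨fun _ _ => rfl, fun _ => rfl⟩

/-- A local signature that declares pairwise distinct constants, with closed types and bodies. -/
structure LocalSig.Regular (Φ : LocalSig) : Prop where
  type_closed : ∀ e ∈ Φ, e.type.Closed
  body_closed : ∀ e ∈ Φ, ∀ t, e.body = some t → t.Closed
  unique : ∀ e ∈ Φ, ∀ e' ∈ Φ, e.name = e'.name → e = e'

theorem Declares.closed {Φ : LocalSig} (hΦ : Φ.Regular) {c : Const} {A : Term}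
    (h : Declares Φ c A) : A.Closed := by
  cases h with
  | glob g => exact g.type_closed
  | loc he => exact hΦ.type_closed _ he

theorem Declares.unique {Φ : LocalSig} (hΦ : Φ.Regular) {c : Const} {A A' : Term}
    (h : Declares Φ c A) (h' : Declares Φ c A') : A = A' := by
  cases h with
  | glob g => cases h'; rfl
  | @loc e he =>
    generalize hc : Const.loc e.name = c at h'
    cases h' with
    | glob g => cases hc
    | loc he' => rw [hΦ.unique _ he _ he' (Const.loc.inj hc)]

/-- Parallel reduction modulo the equational theory of levels. -/
inductive Par (Φ : LocalSig) : Term → Term → Prop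
  | var (n) : Par Φ (.var n) (.var n)
  | const (c) : Par Φ (.const c) (.const c)
  | sort (s) : Par Φ (.sort s) (.sort s)
  | pi {A A' B B'} : Par Φ A A' → Par Φ B B' → Par Φ (.pi A B) (.pi A' B')
  | lam {t t'} : Par Φ t t' → Par Φ (.lam t) (.lam t')
  | app {t t' u u'} : Par Φ t t' → Par Φ u u' → Par Φ (.app t u) (.app t' u')
  | piC {A A' B B'} : Par Φ A A' → Par Φ B B' → Par Φ (.piC A B) (.piC A' B')
  | lamC {t t'} : Par Φ t t' → Par Φ (.lamC t) (.lamC t')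
  | appC {t t' l l'} : Par Φ t t' → LevelEq l l' → Par Φ (.appC t l) (.appC t' l')
  | beta {t t' u u'} : Par Φ t t' → Par Φ u u' → Par Φ (.app (.lam t) u) (t'.inst u')
  | betaC {t t' l l'} : Par Φ t t' → LevelEq l l' → Par Φ (.appC (.lamC t) l) (t'.instC l')
  | delta {e : SigEntry} {c : ℕ} {t : Term} : e ∈ Φ → e.name = c → e.body = some t →
      Par Φ (.const (.loc c)) t
  | tmU (l₁) {l l'} : LevelEq l l' →
      Par Φ (.app (.appC (.const (.glob .Tm)) l₁) (.appC (.const (.glob .U)) l))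
        (.appC (.const (.glob .Ty)) l')
  | appLam (l₁ l₂ l₃ l₄ A B A' B') {t t' u u'} : Par Φ t t' → Par Φ u u' →
      Par Φ (.app (.app (.app (.app (.appC (.appC (.const (.glob .App)) l₁) l₂) A) B)
        (.app (.app (.app (.appC (.appC (.const (.glob .Lam)) l₃) l₄) A') B') t)) u) (.app t' u')

variable {Φ : LocalSig}

theorem Par.refl (t : Term) : Par Φ t t := by
  induction t with
  | var n => exact .var n
  | const c => exact .const c
  | sort s => exact .sort s
  | pi A B ihA ihB => exact .pi ihA ihB
  | lam t ih => exact .lam ih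
  | app t u iht ihu => exact .app iht ihu
  | piC A B ihA ihB => exact .piC ihA ihB
  | lamC t ih => exact .lamC ih
  | appC t l ih => exact .appC ih (.refl l)

theorem Par.rename (hΦ : Φ.Regular) {t t' : Term} (h : Par Φ t t') (ρ ξ : ℕ → ℕ) :
    Par Φ (t.rename ρ ξ) (t'.rename ρ ξ) := by
  induction h generalizing ρ ξ with
  | var n => exact .var _
  | const c => exact .const c
  | sort s => exact .sort s
  | pi _ _ ihA ihB => exact .pi (ihA _ _) (ihB _ _)
  | lam _ ih => exact .lam (ih _ _)
  | app _ _ iht ihu => exact .app (iht _ _) (ihu _ _)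
  | piC _ _ ihA ihB => exact .piC (ihA _ _) (ihB _ _)
  | lamC _ ih => exact .lamC (ih _ _)
  | appC _ hl ih => exact .appC (ih _ _) (hl.rename _)
  | beta _ _ iht ihu => rw [Term.rename_inst]; exact .beta (iht _ _) (ihu _ _)
  | betaC _ hl ih => rw [Term.rename_instC]; exact .betaC (ih _ _) (hl.rename _)
  | delta he hc ht => rw [(hΦ.body_closed _ he _ ht).rename]; exact .delta he hc ht
  | tmU l₁ hl => exact .tmU _ (hl.rename _)
  | appLam l₁ l₂ l₃ l₄ A B A' B' _ _ iht ihu =>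
    exact .appLam _ _ _ _ _ _ _ _ (iht _ _) (ihu _ _)

theorem Par.upSub (hΦ : Φ.Regular) {σ σ' : ℕ → Term} (hσ : ∀ n, Par Φ (σ n) (σ' n)) (n : ℕ) :
    Par Φ (upSub σ n) (upSub σ' n) := by
  cases n
  · exact .var 0
  · exact (hσ _).rename hΦ _ _

/-- Substituting reducts into reducts is what makes a β-step close against steps inside the function
and the argument. Closed bodies are needed for the δ case. -/
theorem Par.subst (hΦ : Φ.Regular) {t t' : Term} (h : Par Φ t t') {σ σ' : ℕ → Term}
    {τ τ' : ℕ → Level} (hσ : ∀ n, Par Φ (σ n) (σ' n)) (hτ : ∀ n, LevelEq (τ n) (τ' n)) :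
    Par Φ (t.subst σ τ) (t'.subst σ' τ') := by
  induction h generalizing σ σ' τ τ' with
  | var n => exact hσ n
  | const c => exact .const c
  | sort s => exact .sort s
  | pi _ _ ihA ihB => exact .pi (ihA hσ hτ) (ihB (Par.upSub hΦ hσ) hτ)
  | lam _ ih => exact .lam (ih (Par.upSub hΦ hσ) hτ)
  | app _ _ iht ihu => exact .app (iht hσ hτ) (ihu hσ hτ)
  | piC _ _ ihA ihB =>
    exact .piC (ihA hσ hτ) (ihB (fun n => (hσ n).rename hΦ _ _) (LevelEq.upSubC hτ))
  | lamC _ ih => exact .lamC (ih (fun n => (hσ n).rename hΦ _ _) (LevelEq.upSubC hτ))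
  | appC _ hl ih => exact .appC (ih hσ hτ) (hl.subst hτ)
  | beta _ _ iht ihu =>
    rw [Term.subst_inst]
    exact .beta (iht (Par.upSub hΦ hσ) hτ) (ihu hσ hτ)
  | betaC _ hl ih =>
    rw [Term.subst_instC]
    exact .betaC (ih (fun n => (hσ n).rename hΦ _ _) (LevelEq.upSubC hτ)) (hl.subst hτ)
  | delta he hc ht => rw [(hΦ.body_closed _ he _ ht).subst]; exact .delta he hc ht
  | tmU l₁ hl => exact .tmU _ (hl.subst hτ)
  | appLam l₁ l₂ l₃ l₄ A B A' B' _ _ iht ihu =>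
    exact .appLam _ _ _ _ _ _ _ _ (iht hσ hτ) (ihu hσ hτ)

theorem Par.inst (hΦ : Φ.Regular) {B B' u u' : Term} (hB : Par Φ B B') (hu : Par Φ u u') :
    Par Φ (B.inst u) (B'.inst u') := by
  refine hB.subst hΦ (fun n => ?_) fun _ => .refl _
  cases n
  · exact hu
  · exact .var _

theorem Par.instC (hΦ : Φ.Regular) {B B' : Term} {l l' : Level} (hB : Par Φ B B')
    (hl : LevelEq l l') : Par Φ (B.instC l) (B'.instC l') := by
  refine hB.subst hΦ (fun n => .var n) fun n => ?_
  cases n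
  · exact hl
  · exact .refl _

/-- Every term has a complete development. -/
theorem Par.triangle (hΦ : Φ.Regular) (t : Term) : ∃ t', ∀ u, Par Φ t u → Par Φ u t' := by
  -- Size rather than structure: the development of an `@`-`λ` redex uses that of the body `t`,
  -- which lies several levels below the application.
  induction hn : sizeOf t using Nat.strong_induction_on generalizing t with
  | _ n ih =>
  subst hn
  have ih' : ∀ s : Term, sizeOf s < sizeOf t → ∃ t', ∀ u, Par Φ s u → Par Φ u t' :=
    fun s hs => ih _ hs s rfl
  clear ih
  cases t with
  | var n => exact ⟨.var n, by rintro _ ⟨⟩; exact .var n⟩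
  | sort s => exact ⟨.sort s, by rintro _ ⟨⟩; exact .sort s⟩
  | const c =>
    by_cases hc : ∃ e ∈ Φ, ∃ t, .loc e.name = c ∧ e.body = some t
    · obtain ⟨e, he, t, rfl, ht⟩ := hc
      refine ⟨t, fun u hu => ?_⟩
      cases hu with
      | const => exact .delta he rfl ht
      | delta he' hc' ht' =>
        cases hΦ.unique _ he' _ he hc'
        cases ht.symm.trans ht'
        exact .refl t
    · refine ⟨.const c, fun u hu => ?_⟩
      cases hu with
      | const => exact .const c
      | delta he' hc' ht' => exact absurd ⟨_, he', _, by rw [hc'], ht'⟩ hc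
  | pi A B =>
    obtain ⟨A', hA⟩ := ih' A (by simp; omega)
    obtain ⟨B', hB⟩ := ih' B (by simp)
    refine ⟨.pi A' B', ?_⟩
    rintro _ ⟨⟩
    exact .pi (hA _ ‹_›) (hB _ ‹_›)
  | lam t =>
    obtain ⟨t', ht⟩ := ih' t (by simp)
    refine ⟨.lam t', ?_⟩
    rintro _ ⟨⟩
    exact .lam (ht _ ‹_›)
  | piC A B =>
    obtain ⟨A', hA⟩ := ih' A (by simp; omega)
    obtain ⟨B', hB⟩ := ih' B (by simp)
    refine ⟨.piC A' B', ?_⟩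
    rintro _ ⟨⟩
    exact .piC (hA _ ‹_›) (hB _ ‹_›)
  | lamC t =>
    obtain ⟨t', ht⟩ := ih' t (by simp)
    refine ⟨.lamC t', ?_⟩
    rintro _ ⟨⟩
    exact .lamC (ht _ ‹_›)
  | appC f l =>
    by_cases hb : ∃ t, f = .lamC t
    · obtain ⟨t, rfl⟩ := hb
      obtain ⟨t', ht⟩ := ih' t (by simp; omega)
      refine ⟨t'.instC l, fun u hu => ?_⟩
      cases hu with
      -- The development keeps the level of the source; a reduct may carry an equal one, and
      -- symmetry of level equality brings it back.
      | appC hf hl => cases hf with | lamC h => exact .betaC (ht _ h) hl.symm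
      | betaC h hl => exact (ht _ h).instC hΦ hl.symm
    · obtain ⟨f', hf'⟩ := ih' f (by simp; omega)
      refine ⟨.appC f' l, fun u hu => ?_⟩
      cases hu with
      | appC hf hl => exact .appC (hf' _ hf) hl.symm
      | betaC h hl => exact absurd ⟨_, rfl⟩ hb
  | app f a =>
    obtain ⟨a', ha'⟩ := ih' a (by simp)
    by_cases hb : ∃ t, f = .lam t
    · obtain ⟨t, rfl⟩ := hb
      obtain ⟨t', ht⟩ := ih' t (by simp; omega)
      refine ⟨t'.inst a', fun u hu => ?_⟩
      cases hu with
      | app hf ha => cases hf with | lam h => exact .beta (ht _ h) (ha' _ ha)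
      | beta h ha => exact (ht _ h).inst hΦ (ha' _ ha)
    by_cases hU : ∃ l₁ l, f = .appC (.const (.glob .Tm)) l₁ ∧ a = .appC (.const (.glob .U)) l
    · obtain ⟨l₁, l, rfl, rfl⟩ := hU
      refine ⟨.appC (.const (.glob .Ty)) l, fun u hu => ?_⟩
      cases hu with
      | app hf ha =>
        cases hf with | appC hf _ => cases hf with | const =>
        cases ha with | appC ha hl => cases ha with | const =>
        exact .tmU _ hl.symm
      | tmU _ hl => exact .appC (.const _) hl.symm
    by_cases hL : ∃ l₁ l₂ l₃ l₄ A B A' B' t,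
        f = .app (.app (.app (.appC (.appC (.const (.glob .App)) l₁) l₂) A) B)
          (.app (.app (.app (.appC (.appC (.const (.glob .Lam)) l₃) l₄) A') B') t)
    · obtain ⟨l₁, l₂, l₃, l₄, A, B, A', B', t, rfl⟩ := hL
      obtain ⟨t', ht⟩ := ih' t (by simp; omega)
      refine ⟨.app t' a', fun u hu => ?_⟩
      cases hu with
      | app hf ha =>
        -- Spines headed by `@` and `λ` with these numbers of arguments evolve only inside their
        -- arguments, so the redex is still present and can be contracted.
        cases hf with | app h h' =>
        cases h with | app h _ => cases h with | app h _ => cases h with | appC h _ =>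
        cases h with | appC h _ => cases h with | const =>
        cases h' with | app h' ht' => cases h' with | app h' _ => cases h' with | app h' _ =>
        cases h' with | appC h' _ => cases h' with | appC h' _ => cases h' with | const =>
        exact .appLam _ _ _ _ _ _ _ _ (ht _ ht') (ha' _ ha)
      | appLam _ _ _ _ _ _ _ _ ht' ha => exact .app (ht _ ht') (ha' _ ha)
    · obtain ⟨f', hf'⟩ := ih' f (by simp; omega)
      refine ⟨.app f' a', fun u hu => ?_⟩
      cases hu with
      | app hf ha => exact .app (hf' _ hf) (ha' _ ha)
      | beta h ha => exact absurd ⟨_, rfl⟩ hb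
      | tmU _ hl => exact absurd ⟨_, _, rfl, rfl⟩ hU
      | appLam => exact absurd ⟨_, _, _, _, _, _, _, _, _, rfl⟩ hL

/-! ### Conversion -/

theorem TermEq.par {t u : Term} (h : TermEq t u) : Par Φ t u := by
  induction h with
  | var n => exact .var n
  | const c => exact .const c
  | sort s => exact .sort s
  | pi _ _ ihA ihB => exact .pi ihA ihB
  | lam _ ih => exact .lam ih
  | app _ _ iht ihu => exact .app iht ihu
  | piC _ _ ihA ihB => exact .piC ihA ihB
  | lamC _ ih => exact .lamC ih
  | appC _ hl ih => exact .appC ih hl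

theorem TermEq.refl (t : Term) : TermEq t t := by
  induction t with
  | var n => exact .var n
  | const c => exact .const c
  | sort s => exact .sort s
  | pi A B ihA ihB => exact .pi ihA ihB
  | lam t ih => exact .lam ih
  | app t u iht ihu => exact .app iht ihu
  | piC A B ihA ihB => exact .piC ihA ihB
  | lamC t ih => exact .lamC ih
  | appC t l ih => exact .appC ih (.refl l)

theorem Contracts.par {t u : Term} (h : Contracts Φ t u) : Par Φ t u := by
  cases h with
  | beta t u => exact .beta (.refl _) (.refl _)
  | betaC t l => exact .betaC (.refl _) (.refl _)
  | delta he ht => exact .delta he rfl ht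
  | tmU l' l => exact .tmU _ (.refl _)
  | appLam => exact .appLam _ _ _ _ _ _ _ _ (.refl _) (.refl _)

theorem Step.par {t u : Term} (h : Step Φ t u) : Par Φ t u := by
  induction h with
  | root h => exact h.par
  | pi_dom B _ ih => exact .pi ih (.refl _)
  | pi_cod A _ ih => exact .pi (.refl _) ih
  | lam _ ih => exact .lam ih
  | app_fun u _ ih => exact .app ih (.refl _)
  | app_arg t _ ih => exact .app (.refl _) ih
  | piC_dom B _ ih => exact .piC ih (.refl _)
  | piC_cod A _ ih => exact .piC (.refl _) ih
  | lamC _ ih => exact .lamC ih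
  | appC l _ ih => exact .appC ih (.refl _)

namespace Conv

theorem refl (t : Term) : Conv Φ t t := Relation.EqvGen.refl t

theorem symm {t u : Term} (h : Conv Φ t u) : Conv Φ u t := Relation.EqvGen.symm _ _ h

theorem trans {t u v : Term} (h : Conv Φ t u) (h' : Conv Φ u v) : Conv Φ t v :=
  Relation.EqvGen.trans _ _ _ h h'

theorem of_step {t u : Term} (h : Step Φ t u) : Conv Φ t u := Relation.EqvGen.rel _ _ (.inl h)

theorem of_termEq {t u : Term} (h : TermEq t u) : Conv Φ t u := Relation.EqvGen.rel _ _ (.inr h)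

theorem of_red {t u : Term} (h : Red Φ t u) : Conv Φ t u := by
  induction h with
  | refl => exact .refl t
  | tail _ h ih => exact ih.trans (of_step h)

theorem map {f : Term → Term} (hs : ∀ t u, Step Φ t u → Step Φ (f t) (f u))
    (he : ∀ t u, TermEq t u → TermEq (f t) (f u)) {t u : Term} (h : Conv Φ t u) :
    Conv Φ (f t) (f u) := by
  induction h with
  | rel t u h => exact Relation.EqvGen.rel _ _ (h.imp (hs t u) (he t u))
  | refl t => exact .refl _
  | symm _ _ _ ih => exact ih.symm
  | trans _ _ _ _ _ ih ih' => exact ih.trans ih'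

theorem pi {A A' B B' : Term} (hA : Conv Φ A A') (hB : Conv Φ B B') :
    Conv Φ (.pi A B) (.pi A' B') :=
  (hA.map (f := fun A => .pi A B) (fun _ _ h => .pi_dom B h) fun _ _ h => .pi h (.refl B)).trans
    (hB.map (fun _ _ h => .pi_cod A' h) fun _ _ h => .pi (.refl A') h)

theorem piC {A A' B B' : Term} (hA : Conv Φ A A') (hB : Conv Φ B B') :
    Conv Φ (.piC A B) (.piC A' B') :=
  (hA.map (f := fun A => .piC A B) (fun _ _ h => .piC_dom B h) fun _ _ h => .piC h (.refl B)).trans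
    (hB.map (fun _ _ h => .piC_cod A' h) fun _ _ h => .piC (.refl A') h)

theorem app {t t' u u' : Term} (ht : Conv Φ t t') (hu : Conv Φ u u') :
    Conv Φ (.app t u) (.app t' u') :=
  (ht.map (f := fun t => .app t u) (fun _ _ h => .app_fun u h) fun _ _ h => .app h (.refl u)).trans
    (hu.map (fun _ _ h => .app_arg t' h) fun _ _ h => .app (.refl t') h)

theorem lam {t t' : Term} (ht : Conv Φ t t') : Conv Φ (.lam t) (.lam t') :=
  ht.map (fun _ _ h => .lam h) fun _ _ h => .lam h

theorem lamC {t t' : Term} (ht : Conv Φ t t') : Conv Φ (.lamC t) (.lamC t') :=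
  ht.map (fun _ _ h => .lamC h) fun _ _ h => .lamC h

theorem appC {t t' : Term} {l l' : Level} (ht : Conv Φ t t') (hl : LevelEq l l') :
    Conv Φ (.appC t l) (.appC t' l') :=
  (ht.map (f := fun t => .appC t l) (fun _ _ h => .appC l h) fun _ _ h => .appC h (.refl l)).trans
    (of_termEq (.appC (.refl t') hl))

theorem of_par {t u : Term} (h : Par Φ t u) : Conv Φ t u := by
  induction h with
  | var n => exact .refl _
  | const c => exact .refl _
  | sort s => exact .refl _
  | pi _ _ ihA ihB => exact ihA.pi ihB
  | lam _ ih => exact ih.lam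
  | app _ _ iht ihu => exact iht.app ihu
  | piC _ _ ihA ihB => exact ihA.piC ihB
  | lamC _ ih => exact ih.lamC
  | appC _ hl ih => exact ih.appC hl
  | beta _ _ iht ihu => exact (iht.lam.app ihu).trans (of_step (.root (.beta _ _)))
  | betaC _ hl ih => exact (ih.lamC.appC hl).trans (of_step (.root (.betaC _ _)))
  | delta he hc ht => subst hc; exact of_step (.root (.delta he ht))
  | tmU l₁ hl => exact (of_step (.root (.tmU _ _))).trans ((refl _).appC hl)
  | appLam l₁ l₂ l₃ l₄ A B A' B' _ _ iht ihu =>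
    exact (of_step (.root (.appLam _ _ _ _ _ _ _ _ _ _))).trans (iht.app ihu)

theorem subst (hΦ : Φ.Regular) {t u : Term} (h : Conv Φ t u) (σ : ℕ → Term) (τ : ℕ → Level) :
    Conv Φ (t.subst σ τ) (u.subst σ τ) := by
  induction h with
  | rel t u h =>
    exact of_par ((h.elim Step.par TermEq.par).subst hΦ (fun _ => .refl _) fun _ => .refl _)
  | refl t => exact .refl _
  | symm _ _ _ ih => exact ih.symm
  | trans _ _ _ _ _ ih ih' => exact ih.trans ih'

theorem rename (hΦ : Φ.Regular) {t u : Term} (h : Conv Φ t u) (ρ ξ : ℕ → ℕ) :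
    Conv Φ (t.rename ρ ξ) (u.rename ρ ξ) := by
  simp only [Term.rename_eq_subst]
  exact h.subst hΦ _ _

theorem inst (hΦ : Φ.Regular) {t t' : Term} (h : Conv Φ t t') (u : Term) :
    Conv Φ (t.inst u) (t'.inst u) := h.subst hΦ _ _

theorem instC (hΦ : Φ.Regular) {t t' : Term} (h : Conv Φ t t') (l : Level) :
    Conv Φ (t.instC l) (t'.instC l) := h.subst hΦ _ _

/-- Two parallel steps from one term meet at its complete development, so joinability is an
equivalence relation; it contains both generators of conversion. -/
theorem church_rosser (hΦ : Φ.Regular) {t u : Term} (h : Conv Φ t u) :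
    Relation.Join (Relation.ReflTransGen (Par Φ)) t u := by
  have hd : ∀ a b c, Par Φ a b → Par Φ a c →
      ∃ d, Relation.ReflGen (Par Φ) b d ∧ Relation.ReflTransGen (Par Φ) c d := by
    intro a b c hb hc
    obtain ⟨d, hd⟩ := Par.triangle hΦ a
    exact ⟨d, .single (hd b hb), .single (hd c hc)⟩
  have heq := Relation.equivalence_join_reflTransGen hd
  induction h with
  | rel t u h => exact ⟨u, .single (h.elim Step.par TermEq.par), .refl⟩
  | refl t => exact heq.refl t
  | symm _ _ _ ih => exact heq.symm ih
  | trans _ _ _ _ _ ih ih' => exact heq.trans ih ih'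

end Conv

/-! ### Reducts of rigid terms and injectivity of type formers -/

theorem pars_sort {s : Srt} {v : Term} (h : Relation.ReflTransGen (Par Φ) (.sort s) v) :
    v = .sort s := by
  induction h with
  | refl => rfl
  | tail _ h ih => subst ih; cases h; rfl

theorem pars_pi {A B v : Term} (h : Relation.ReflTransGen (Par Φ) (.pi A B) v) :
    ∃ A' B', v = .pi A' B' ∧ Conv Φ A A' ∧ Conv Φ B B' := by
  induction h with
  | refl => exact ⟨A, B, rfl, .refl A, .refl B⟩
  | tail _ h ih =>
    obtain ⟨A', B', rfl, hA, hB⟩ := ih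
    cases h with
    | pi hA' hB' => exact ⟨_, _, rfl, hA.trans (.of_par hA'), hB.trans (.of_par hB')⟩

theorem pars_piC {A B v : Term} (h : Relation.ReflTransGen (Par Φ) (.piC A B) v) :
    ∃ A' B', v = .piC A' B' ∧ Conv Φ A A' ∧ Conv Φ B B' := by
  induction h with
  | refl => exact ⟨A, B, rfl, .refl A, .refl B⟩
  | tail _ h ih =>
    obtain ⟨A', B', rfl, hA, hB⟩ := ih
    cases h with
    | piC hA' hB' => exact ⟨_, _, rfl, hA.trans (.of_par hA'), hB.trans (.of_par hB')⟩

/-- The only rule headed by `Tm` requires `U` in its second argument, and no rule is headed by `Π`;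
hence this shape is never lost. The outer level is left untracked because the levels of `Π` already
determine what is needed. -/
theorem pars_tTm_tPi {l₀ l l' : Level} {A B v : Term}
    (h : Relation.ReflTransGen (Par Φ) (tTm l₀ (tPi l l' A B)) v) :
    ∃ l₀' m m' A' B', v = tTm l₀' (tPi m m' A' B') ∧ LevelEq l m ∧ LevelEq l' m' ∧
      Conv Φ A A' ∧ Conv Φ B B' := by
  induction h with
  | refl => exact ⟨_, _, _, _, _, rfl, .refl _, .refl _, .refl _, .refl _⟩
  | tail _ h ih =>
    obtain ⟨l₀', m, m', A', B', rfl, hl, hl', hA, hB⟩ := ih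
    unfold tTm tPi at h
    cases h with | app hf ha =>
    cases hf with | appC hf _ => cases hf with | const =>
    cases ha with | app ha hB' => cases ha with | app ha hA' => cases ha with | appC ha hm' =>
    cases ha with | appC ha hm => cases ha with | const =>
    exact ⟨_, _, _, _, _, rfl, hl.trans hm, hl'.trans hm', hA.trans (.of_par hA'),
      hB.trans (.of_par hB')⟩

namespace Conv

theorem sort_inj (hΦ : Φ.Regular) {s s' : Srt} (h : Conv Φ (.sort s) (.sort s')) : s = s' := by
  obtain ⟨v, h₁, h₂⟩ := h.church_rosser hΦ
  exact Term.sort.inj ((pars_sort h₁).symm.trans (pars_sort h₂))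

theorem pi_inj (hΦ : Φ.Regular) {A B A' B' : Term} (h : Conv Φ (.pi A B) (.pi A' B')) :
    Conv Φ A A' ∧ Conv Φ B B' := by
  obtain ⟨v, h₁, h₂⟩ := h.church_rosser hΦ
  obtain ⟨A₁, B₁, rfl, hA, hB⟩ := pars_pi h₁
  obtain ⟨A₂, B₂, hv, hA', hB'⟩ := pars_pi h₂
  cases hv
  exact ⟨hA.trans hA'.symm, hB.trans hB'.symm⟩

theorem piC_inj (hΦ : Φ.Regular) {A B A' B' : Term} (h : Conv Φ (.piC A B) (.piC A' B')) :
    Conv Φ A A' ∧ Conv Φ B B' := by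
  obtain ⟨v, h₁, h₂⟩ := h.church_rosser hΦ
  obtain ⟨A₁, B₁, rfl, hA, hB⟩ := pars_piC h₁
  obtain ⟨A₂, B₂, hv, hA', hB'⟩ := pars_piC h₂
  cases hv
  exact ⟨hA.trans hA'.symm, hB.trans hB'.symm⟩

theorem tTm_tPi_inj (hΦ : Φ.Regular) {l₁ l₂ l l' m m' : Level} {A B A' B' : Term}
    (h : Conv Φ (tTm l₁ (tPi l l' A B)) (tTm l₂ (tPi m m' A' B'))) :
    LevelEq l m ∧ LevelEq l' m' ∧ Conv Φ A A' ∧ Conv Φ B B' := by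
  obtain ⟨v, h₁, h₂⟩ := h.church_rosser hΦ
  obtain ⟨_, _, _, _, _, rfl, hl, hl', hA, hB⟩ := pars_tTm_tPi h₁
  obtain ⟨_, _, _, _, _, hv, hm, hm', hA', hB'⟩ := pars_tTm_tPi h₂
  cases hv
  exact ⟨hl.trans hm.symm, hl'.trans hm'.symm, hA.trans hA'.symm, hB.trans hB'.symm⟩

end Conv

/-! ### Renaming and substitution in derivations -/

variable {Ξ : Finset ℕ}

theorem Der.wf {Γ : Ctx} {J : Judgment} (h : Der Φ Ξ Γ J) : Der Φ Ξ Γ .wf := by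
  induction h with
  | emptyCtx => exact .emptyCtx
  | extCtx h _ => exact .extCtx h
  | extCtxC h _ => exact .extCtxC h
  | sort h => exact h
  | var _ h => exact h
  | varC _ h => exact h
  | varΞ _ h => exact h
  | cons _ h => exact h
  | zero h => exact h
  | succ _ ih => exact ih
  | sup _ _ ih => exact ih
  | conv _ _ _ ih => exact ih
  | convC _ _ _ ih => exact ih
  | arrow _ _ ih => exact ih
  | arrowC _ _ ih => exact ih
  | abs _ _ _ ih => exact ih
  | absC _ _ _ ih => exact ih
  | app _ _ ih => exact ih
  | appC _ _ ih => exact ih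

theorem Der.lvl {Γ : Ctx} (h : Der Φ Ξ Γ .wf) : Der Φ Ξ Γ (.term tLvl (.sort .type)) :=
  .cons (.glob .Lvl) h

/-- Simultaneous substitution in a judgment. -/
def Judgment.subst (σ : ℕ → Term) (τ : ℕ → Level) : Judgment → Judgment
  | wf => wf
  | term t A => term (t.subst σ τ) (A.subst σ τ)
  | level l A => level (l.subst τ) (A.subst σ τ)

/-- Simultaneous renaming in a judgment. -/
def Judgment.rename (ρ ξ : ℕ → ℕ) : Judgment → Judgment
  | wf => wf
  | term t A => term (t.rename ρ ξ) (A.rename ρ ξ)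
  | level l A => level (l.rename ξ) (A.rename ρ ξ)

/-- `ρ` and `ξ` rename the variables of `Γ` to variables of `Γ'` of the same types. -/
structure Ctx.Ren (Γ Γ' : Ctx) (ρ ξ : ℕ → ℕ) : Prop where
  var : ∀ {n A}, Ctx.HasVar Γ n A → Ctx.HasVar Γ' (ρ n) (A.rename ρ ξ)
  varC : ∀ {n A}, Ctx.HasVarC Γ n A → Ctx.HasVarC Γ' (ξ n) (A.rename ρ ξ)

namespace Ctx.Ren

theorem up {Γ Γ' : Ctx} {ρ ξ : ℕ → ℕ} (h : Ctx.Ren Γ Γ' ρ ξ) (A : Term) :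
    Ctx.Ren (.reg A :: Γ) (.reg (A.rename ρ ξ) :: Γ') (upRen ρ) ξ where
  var hn := by
    cases hn with
    | here => rw [Term.rename_shift]; exact .here _ _
    | reg _ hn => rw [Term.rename_shift]; exact .reg _ (h.var hn)
  varC hn := by
    cases hn with
    | reg _ hn => rw [Term.rename_shift]; exact .reg _ (h.varC hn)

theorem upC {Γ Γ' : Ctx} {ρ ξ : ℕ → ℕ} (h : Ctx.Ren Γ Γ' ρ ξ) (A : Term) :
    Ctx.Ren (.conf A :: Γ) (.conf (A.rename ρ ξ) :: Γ') ρ (upRen ξ) where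
  var hn := by
    cases hn with
    | conf _ hn => rw [Term.rename_shiftC]; exact .conf _ (h.var hn)
  varC hn := by
    cases hn with
    | here => rw [Term.rename_shiftC]; exact .here _ _
    | conf _ hn => rw [Term.rename_shiftC]; exact .conf _ (h.varC hn)

theorem shift (Γ : Ctx) (A : Term) : Ctx.Ren Γ (.reg A :: Γ) Nat.succ id :=
  ⟨fun h => .reg _ h, fun h => .reg _ h⟩

theorem shiftC (Γ : Ctx) (A : Term) : Ctx.Ren Γ (.conf A :: Γ) id Nat.succ :=
  ⟨fun h => .conf _ h, fun h => .conf _ h⟩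

end Ctx.Ren

/-- Proved before substitution, which needs weakening to pass under binders. Well-formedness of the
target is a separate premise, since it cannot be derived from the source context; under a binder it
is rebuilt from the renamed domain. -/
theorem Der.rename (hΦ : Φ.Regular) {Γ : Ctx} {J : Judgment} (h : Der Φ Ξ Γ J) {Γ' : Ctx}
    {ρ ξ : ℕ → ℕ} (hr : Ctx.Ren Γ Γ' ρ ξ) (hw : Der Φ Ξ Γ' .wf) :
    Der Φ Ξ Γ' (J.rename ρ ξ) := by
  induction h generalizing Γ' ρ ξ with
  | emptyCtx => exact hw
  | extCtx _ _ => exact hw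
  | extCtxC _ _ => exact hw
  | sort _ _ => exact .sort hw
  | var hn _ _ => exact .var (hr.var hn) hw
  | varC hn _ _ => exact .varC (hr.varC hn) hw
  | varΞ hj _ _ => exact .varΞ hj hw
  | cons hc _ _ =>
    simp only [Judgment.rename, Term.rename, (hc.closed hΦ).rename]
    exact .cons hc hw
  | zero _ _ => exact .zero hw
  | succ _ ih => exact .succ (ih hr hw)
  | sup _ _ ih ih' => exact .sup (ih hr hw) (ih' hr hw)
  | conv hAB _ _ ih ih' => exact .conv (hAB.rename hΦ _ _) (ih hr hw) (ih' hr hw)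
  | convC hAB _ _ ih ih' => exact .convC (hAB.rename hΦ _ _) (ih hr hw) (ih' hr hw)
  | arrow _ _ ihA ihB => exact .arrow (ihA hr hw) (ihB (hr.up _) (.extCtx (ihA hr hw)))
  | arrowC _ _ ihA ihB => exact .arrowC (ihA hr hw) (ihB (hr.upC _) (.extCtxC (ihA hr hw)))
  | abs _ _ _ ihA ihB iht =>
    exact .abs (ihA hr hw) (ihB (hr.up _) (.extCtx (ihA hr hw)))
      (iht (hr.up _) (.extCtx (ihA hr hw)))
  | absC _ _ _ ihA ihB iht =>
    exact .absC (ihA hr hw) (ihB (hr.upC _) (.extCtxC (ihA hr hw)))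
      (iht (hr.upC _) (.extCtxC (ihA hr hw)))
  | app _ _ iht ihu =>
    simp only [Judgment.rename, Term.rename_inst]
    exact .app (iht hr hw) (ihu hr hw)
  | appC _ _ iht ihl =>
    simp only [Judgment.rename, Term.rename_instC]
    exact .appC (iht hr hw) (ihl hr hw)

theorem Der.shift (hΦ : Φ.Regular) {Γ : Ctx} {t A B : Term} (h : Der Φ Ξ Γ (.term t A))
    (hB : Der Φ Ξ Γ (.term B (.sort .type))) :
    Der Φ Ξ (.reg B :: Γ) (.term t.shift A.shift) :=
  h.rename hΦ (Ctx.Ren.shift Γ B) (.extCtx hB)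

theorem Der.shiftC (hΦ : Φ.Regular) {Γ : Ctx} {t A B : Term} (h : Der Φ Ξ Γ (.term t A))
    (hB : Der Φ Ξ Γ (.term B (.sort .type))) :
    Der Φ Ξ (.conf B :: Γ) (.term t.shiftC A.shiftC) :=
  h.rename hΦ (Ctx.Ren.shiftC Γ B) (.extCtxC hB)

/-- `σ` and `τ` map the variables of `Γ` to terms and levels over `Γ'` of the same types. -/
structure IsSubst (Φ : LocalSig) (Ξ : Finset ℕ) (Γ Γ' : Ctx) (σ : ℕ → Term) (τ : ℕ → Level) :
    Prop where
  var : ∀ {n A}, Ctx.HasVar Γ n A → Der Φ Ξ Γ' (.term (σ n) (A.subst σ τ))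
  varC : ∀ {n A}, Ctx.HasVarC Γ n A → Der Φ Ξ Γ' (.level (τ n) (A.subst σ τ))

namespace IsSubst

theorem up (hΦ : Φ.Regular) {Γ Γ' : Ctx} {σ : ℕ → Term} {τ : ℕ → Level}
    (h : IsSubst Φ Ξ Γ Γ' σ τ) {A : Term} (hA : Der Φ Ξ Γ' (.term (A.subst σ τ) (.sort .type))) :
    IsSubst Φ Ξ (.reg A :: Γ) (.reg (A.subst σ τ) :: Γ') (upSub σ) τ where
  var hn := by
    cases hn with
    | here => rw [Term.subst_shift]; exact .var (.here _ _) (.extCtx hA)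
    | reg _ hn => rw [Term.subst_shift]; exact (h.var hn).shift hΦ hA
  varC hn := by
    cases hn with
    | @reg _ n A' _ hn =>
      have := (h.varC hn).rename hΦ (Ctx.Ren.shift Γ' _) (.extCtx hA)
      rw [Term.subst_shift]
      simp only [Judgment.rename, Level.rename_eq_subst, id] at this
      rwa [Level.subst_idx] at this

theorem upC (hΦ : Φ.Regular) {Γ Γ' : Ctx} {σ : ℕ → Term} {τ : ℕ → Level}
    (h : IsSubst Φ Ξ Γ Γ' σ τ) {A : Term} (hA : Der Φ Ξ Γ' (.term (A.subst σ τ) (.sort .type))) :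
    IsSubst Φ Ξ (.conf A :: Γ) (.conf (A.subst σ τ) :: Γ') (fun n => (σ n).shiftC)
      (upSubC τ) where
  var hn := by
    cases hn with
    | conf _ hn => rw [Term.subst_shiftC]; exact (h.var hn).shiftC hΦ hA
  varC hn := by
    cases hn with
    | here => rw [Term.subst_shiftC]; exact .varC (.here _ _) (.extCtxC hA)
    | conf _ hn =>
      rw [Term.subst_shiftC]
      exact (h.varC hn).rename hΦ (Ctx.Ren.shiftC Γ' _) (.extCtxC hA)

end IsSubst

/-- One simultaneous substitution lemma covers instantiation, change of a context type by
conversion, and weakening from the empty context. -/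
theorem Der.subst (hΦ : Φ.Regular) {Γ : Ctx} {J : Judgment} (h : Der Φ Ξ Γ J) {Γ' : Ctx}
    {σ : ℕ → Term} {τ : ℕ → Level} (hs : IsSubst Φ Ξ Γ Γ' σ τ) (hw : Der Φ Ξ Γ' .wf) :
    Der Φ Ξ Γ' (J.subst σ τ) := by
  induction h generalizing Γ' σ τ with
  | emptyCtx => exact hw
  | extCtx _ _ => exact hw
  | extCtxC _ _ => exact hw
  | sort _ _ => exact .sort hw
  | var hn _ _ => exact hs.var hn
  | varC hn _ _ => exact hs.varC hn
  | varΞ hj _ _ => exact .varΞ hj hw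
  | cons hc _ _ =>
    simp only [Judgment.subst, Term.subst, (hc.closed hΦ).subst]
    exact .cons hc hw
  | zero _ _ => exact .zero hw
  | succ _ ih => exact .succ (ih hs hw)
  | sup _ _ ih ih' => exact .sup (ih hs hw) (ih' hs hw)
  | conv hAB _ _ ih ih' => exact .conv (hAB.subst hΦ _ _) (ih hs hw) (ih' hs hw)
  | convC hAB _ _ ih ih' => exact .convC (hAB.subst hΦ _ _) (ih hs hw) (ih' hs hw)
  | arrow _ _ ihA ihB =>
    exact .arrow (ihA hs hw) (ihB (hs.up hΦ (ihA hs hw)) (.extCtx (ihA hs hw)))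
  | arrowC _ _ ihA ihB =>
    exact .arrowC (ihA hs hw) (ihB (hs.upC hΦ (ihA hs hw)) (.extCtxC (ihA hs hw)))
  | abs _ _ _ ihA ihB iht =>
    exact .abs (ihA hs hw) (ihB (hs.up hΦ (ihA hs hw)) (.extCtx (ihA hs hw)))
      (iht (hs.up hΦ (ihA hs hw)) (.extCtx (ihA hs hw)))
  | absC _ _ _ ihA ihB iht =>
    exact .absC (ihA hs hw) (ihB (hs.upC hΦ (ihA hs hw)) (.extCtxC (ihA hs hw)))
      (iht (hs.upC hΦ (ihA hs hw)) (.extCtxC (ihA hs hw)))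
  | app _ _ iht ihu =>
    simp only [Judgment.subst, Term.subst_inst]
    exact .app (iht hs hw) (ihu hs hw)
  | appC _ _ iht ihl =>
    simp only [Judgment.subst, Term.subst_instC]
    exact .appC (iht hs hw) (ihl hs hw)

theorem Term.inst_shift (t u : Term) : t.shift.inst u = t := by
  rw [inst, shift, subst_rename]
  exact t.subst_var

theorem Term.instC_shiftC (t : Term) (l : Level) : t.shiftC.instC l = t := by
  rw [instC, shiftC, subst_rename]
  exact t.subst_var

theorem Der.inst (hΦ : Φ.Regular) {Γ : Ctx} {A u t B : Term}
    (h : Der Φ Ξ (.reg A :: Γ) (.term t B)) (hu : Der Φ Ξ Γ (.term u A)) :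
    Der Φ Ξ Γ (.term (t.inst u) (B.inst u)) := by
  refine h.subst hΦ ⟨fun {n A'} hn => ?_, fun {n A'} hn => ?_⟩ hu.wf
  · cases hn with
    | here =>
      change Der Φ Ξ Γ (.term _ (Term.inst (Term.shift _) u))
      rw [Term.inst_shift]
      exact hu
    | reg _ hn =>
      change Der Φ Ξ Γ (.term _ (Term.inst (Term.shift _) u))
      rw [Term.inst_shift]
      exact .var hn hu.wf
  · cases hn with
    | reg _ hn =>
      change Der Φ Ξ Γ (.level _ (Term.inst (Term.shift _) u))
      rw [Term.inst_shift]
      exact .varC hn hu.wf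

theorem Der.instC (hΦ : Φ.Regular) {Γ : Ctx} {A t B : Term} {l : Level}
    (h : Der Φ Ξ (.conf A :: Γ) (.term t B)) (hl : Der Φ Ξ Γ (.level l A)) :
    Der Φ Ξ Γ (.term (t.instC l) (B.instC l)) := by
  refine h.subst hΦ ⟨fun {n A'} hn => ?_, fun {n A'} hn => ?_⟩ hl.wf
  · cases hn with
    | conf _ hn =>
      change Der Φ Ξ Γ (.term _ (Term.instC (Term.shiftC _) l))
      rw [Term.instC_shiftC]
      exact .var hn hl.wf
  · cases hn with
    | here =>
      change Der Φ Ξ Γ (.level _ (Term.instC (Term.shiftC _) l))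
      rw [Term.instC_shiftC]
      exact hl
    | conf _ hn =>
      change Der Φ Ξ Γ (.level _ (Term.instC (Term.shiftC _) l))
      rw [Term.instC_shiftC]
      exact .varC hn hl.wf

/-- The identity is a well-typed substitution between the two contexts: only the last variable has
to be retyped, by conversion. -/
theorem Der.conv_ctx (hΦ : Φ.Regular) {Γ : Ctx} {A A' t B : Term}
    (h : Der Φ Ξ (.reg A :: Γ) (.term t B)) (hAA' : Conv Φ A A')
    (hA : Der Φ Ξ Γ (.term A (.sort .type))) (hA' : Der Φ Ξ Γ (.term A' (.sort .type))) :
    Der Φ Ξ (.reg A' :: Γ) (.term t B) := by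
  have hw : Der Φ Ξ (.reg A' :: Γ) .wf := .extCtx hA'
  have := h.subst hΦ (Γ' := .reg A' :: Γ) (σ := .var) (τ := .idx)
    ⟨fun {n B} hn => ?_, fun {n B} hn => ?_⟩ hw
  · simpa only [Judgment.subst, Term.subst_var] using this
  · rw [Term.subst_var]
    cases hn with
    | here => exact .conv (hAA'.symm.rename hΦ _ _) (.var (.here _ _) hw) (hA.shift hΦ hA')
    | reg _ hn => exact .var (.reg _ hn) hw
  · rw [Term.subst_var]
    cases hn with
    | reg _ hn => exact .varC (.reg _ hn) hw

theorem Der.conv_ctxC (hΦ : Φ.Regular) {Γ : Ctx} {A A' t B : Term}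
    (h : Der Φ Ξ (.conf A :: Γ) (.term t B)) (hAA' : Conv Φ A A')
    (hA : Der Φ Ξ Γ (.term A (.sort .type))) (hA' : Der Φ Ξ Γ (.term A' (.sort .type))) :
    Der Φ Ξ (.conf A' :: Γ) (.term t B) := by
  have hw : Der Φ Ξ (.conf A' :: Γ) .wf := .extCtxC hA'
  have := h.subst hΦ (Γ' := .conf A' :: Γ) (σ := .var) (τ := .idx)
    ⟨fun {n B} hn => ?_, fun {n B} hn => ?_⟩ hw
  · simpa only [Judgment.subst, Term.subst_var] using this
  · rw [Term.subst_var]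
    cases hn with
    | conf _ hn => exact .var (.conf _ hn) hw
  · rw [Term.subst_var]
    cases hn with
    | here => exact .convC (hAA'.symm.rename hΦ _ _) (.varC (.here _ _) hw) (hA.shiftC hΦ hA')
    | conf _ hn => exact .varC (.conf _ hn) hw

/-- A closed judgment holds in every context. -/
theorem Der.of_nil (hΦ : Φ.Regular) {t A : Term} (h : Der Φ Ξ [] (.term t A)) {Γ : Ctx}
    (hw : Der Φ Ξ Γ .wf) : Der Φ Ξ Γ (.term t A) := by
  have := h.subst hΦ (Γ' := Γ) (σ := .var) (τ := .idx)
    ⟨fun hn => (nomatch hn), fun hn => (nomatch hn)⟩ hw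
  simpa only [Judgment.subst, Term.subst_var] using this

/-! ### Monotonicity in the signature, and closedness from typing -/

theorem Step.mono {Φ' : LocalSig} (hs : Φ ⊆ Φ') {t u : Term} (h : Step Φ t u) : Step Φ' t u := by
  induction h with
  | root h =>
    cases h with
    | beta t u => exact .root (.beta _ _)
    | betaC t l => exact .root (.betaC _ _)
    | delta he ht => exact .root (.delta (hs he) ht)
    | tmU l' l => exact .root (.tmU _ _)
    | appLam => exact .root (.appLam _ _ _ _ _ _ _ _ _ _)
  | pi_dom B _ ih => exact .pi_dom B ih
  | pi_cod A _ ih => exact .pi_cod A ih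
  | lam _ ih => exact .lam ih
  | app_fun u _ ih => exact .app_fun u ih
  | app_arg t _ ih => exact .app_arg t ih
  | piC_dom B _ ih => exact .piC_dom B ih
  | piC_cod A _ ih => exact .piC_cod A ih
  | lamC _ ih => exact .lamC ih
  | appC l _ ih => exact .appC l ih

theorem Conv.mono {Φ' : LocalSig} (hs : Φ ⊆ Φ') {t u : Term} (h : Conv Φ t u) : Conv Φ' t u := by
  induction h with
  | rel t u h => exact Relation.EqvGen.rel _ _ (h.imp_left (Step.mono hs))
  | refl t => exact .refl _
  | symm _ _ _ ih => exact ih.symm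
  | trans _ _ _ _ _ ih ih' => exact ih.trans ih'

theorem Der.mono {Φ' : LocalSig} (hs : Φ ⊆ Φ') {Ξ' : Finset ℕ} (hΞ : Ξ ⊆ Ξ') {Γ : Ctx}
    {J : Judgment} (h : Der Φ Ξ Γ J) : Der Φ' Ξ' Γ J := by
  induction h with
  | emptyCtx => exact .emptyCtx
  | extCtx _ ih => exact .extCtx ih
  | extCtxC _ ih => exact .extCtxC ih
  | sort _ ih => exact .sort ih
  | var hn _ ih => exact .var hn ih
  | varC hn _ ih => exact .varC hn ih
  | varΞ hj _ ih => exact .varΞ (hΞ hj) ih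
  | cons hc _ ih =>
    refine .cons ?_ ih
    cases hc with
    | glob g => exact .glob g
    | loc he => exact .loc (hs he)
  | zero _ ih => exact .zero ih
  | succ _ ih => exact .succ ih
  | sup _ _ ih ih' => exact .sup ih ih'
  | conv hAB _ _ ih ih' => exact .conv (hAB.mono hs) ih ih'
  | convC hAB _ _ ih ih' => exact .convC (hAB.mono hs) ih ih'
  | arrow _ _ ihA ihB => exact .arrow ihA ihB
  | arrowC _ _ ihA ihB => exact .arrowC ihA ihB
  | abs _ _ _ ihA ihB iht => exact .abs ihA ihB iht
  | absC _ _ _ ihA ihB iht => exact .absC ihA ihB iht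
  | app _ _ iht ihu => exact .app iht ihu
  | appC _ _ iht ihl => exact .appC iht ihl

/-- A substitution that fixes the variables of the context fixes the subject of a judgment. -/
theorem Der.subst_eq {Γ : Ctx} {J : Judgment} (h : Der Φ Ξ Γ J) {σ : ℕ → Term} {τ : ℕ → Level}
    (hσ : ∀ n A, Ctx.HasVar Γ n A → σ n = .var n)
    (hτ : ∀ n A, Ctx.HasVarC Γ n A → τ n = .idx n) :
    match J with
    | .wf => True
    | .term t _ => t.subst σ τ = t
    | .level l _ => l.subst τ = l := by
  have up : ∀ {Γ : Ctx} {σ : ℕ → Term} (A : Term),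
      (∀ n A, Ctx.HasVar Γ n A → σ n = .var n) →
      ∀ n B, Ctx.HasVar (.reg A :: Γ) n B → upSub σ n = .var n := by
    intro Γ σ A hσ n B hn
    cases hn with
    | here => rfl
    | reg _ hn => simp [upSub, hσ _ _ hn, Term.shift, Term.rename]
  have up' : ∀ {Γ : Ctx} {τ : ℕ → Level} (A : Term),
      (∀ n A, Ctx.HasVarC Γ n A → τ n = .idx n) →
      ∀ n B, Ctx.HasVarC (.reg A :: Γ) n B → τ n = .idx n := by
    intro Γ τ A hτ n B hn
    cases hn with
    | reg _ hn => exact hτ _ _ hn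
  have upC : ∀ {Γ : Ctx} {τ : ℕ → Level} (A : Term),
      (∀ n A, Ctx.HasVarC Γ n A → τ n = .idx n) →
      ∀ n B, Ctx.HasVarC (.conf A :: Γ) n B → upSubC τ n = .idx n := by
    intro Γ τ A hτ n B hn
    cases hn with
    | here => rfl
    | conf _ hn => simp [upSubC, hτ _ _ hn, Level.rename]
  have upC' : ∀ {Γ : Ctx} {σ : ℕ → Term} (A : Term),
      (∀ n A, Ctx.HasVar Γ n A → σ n = .var n) →
      ∀ n B, Ctx.HasVar (.conf A :: Γ) n B → (σ n).shiftC = .var n := by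
    intro Γ σ A hσ n B hn
    cases hn with
    | conf _ hn => simp [hσ _ _ hn, Term.shiftC, Term.rename]
  induction h generalizing σ τ with
  | emptyCtx => trivial
  | extCtx _ _ => trivial
  | extCtxC _ _ => trivial
  | sort _ _ => rfl
  | var hn _ _ => exact hσ _ _ hn
  | varC hn _ _ => exact hτ _ _ hn
  | varΞ hj _ _ => rfl
  | cons hc _ _ => rfl
  | zero _ _ => rfl
  | succ _ ih => exact congrArg _ (ih hσ hτ)
  | sup _ _ ih ih' => exact congrArg₂ _ (ih hσ hτ) (ih' hσ hτ)
  | conv _ _ _ ih _ => exact ih hσ hτ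
  | convC _ _ _ ih _ => exact ih hσ hτ
  | arrow _ _ ihA ihB => exact congrArg₂ _ (ihA hσ hτ) (ihB (up _ hσ) (up' _ hτ))
  | arrowC _ _ ihA ihB => exact congrArg₂ _ (ihA hσ hτ) (ihB (upC' _ hσ) (upC _ hτ))
  | abs _ _ _ _ _ iht => exact congrArg _ (iht (up _ hσ) (up' _ hτ))
  | absC _ _ _ _ _ iht => exact congrArg _ (iht (upC' _ hσ) (upC _ hτ))
  | app _ _ iht ihu => exact congrArg₂ _ (iht hσ hτ) (ihu hσ hτ)
  | appC _ _ iht ihl => exact congrArg₂ _ (iht hσ hτ) (ihl hσ hτ)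

/-- The free level variables of a typed subject all come from `Ξ`. Only subjects are covered, but a
type with a sort is itself a subject. -/
theorem Der.lsubst_eq {Γ : Ctx} {J : Judgment} (h : Der Φ Ξ Γ J) {θ : LevelSubst}
    (hθ : ∀ j ∈ Ξ, θ.toFun j = .name j) :
    match J with
    | .wf => True
    | .term t _ => t.lsubst θ = t
    | .level l _ => l.lsubst θ = l := by
  induction h with
  | emptyCtx => trivial
  | extCtx _ _ => trivial
  | extCtxC _ _ => trivial
  | sort _ _ => rfl
  | var _ _ _ => rfl
  | varC _ _ _ => rfl
  | varΞ hj _ _ => exact hθ _ hj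
  | cons _ _ _ => rfl
  | zero _ _ => rfl
  | succ _ ih => exact congrArg _ ih
  | sup _ _ ih ih' => exact congrArg₂ _ ih ih'
  | conv _ _ _ ih _ => exact ih
  | convC _ _ _ ih _ => exact ih
  | arrow _ _ ihA ihB => exact congrArg₂ _ ihA ihB
  | arrowC _ _ ihA ihB => exact congrArg₂ _ ihA ihB
  | abs _ _ _ _ _ iht => exact congrArg _ iht
  | absC _ _ _ _ _ iht => exact congrArg _ iht
  | app _ _ iht ihu => exact congrArg₂ _ iht ihu
  | appC _ _ iht ihl => exact congrArg₂ _ iht ihl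

/-- Well-formedness of a signature does not mention closedness; it is recovered from typing with no
context entries and no level variables. -/
theorem Der.closed {t A : Term} (h : Der Φ ∅ [] (.term t A)) : t.Closed where
  subst _ _ := h.subst_eq (fun _ _ hn => (nomatch hn)) (fun _ _ hn => (nomatch hn))
  lsubst _ := h.lsubst_eq (by simp)

/-! ### Inversion of derivations -/

namespace Der

/-- As in the inversions below, a derivation ends with its structural rule followed by conversions,
so a type is known only up to `≡`. -/
theorem const_inv (hΦ : Φ.Regular) {Γ : Ctx} {c : Const} {A T : Term} (hc : Declares Φ c A)
    (h : Der Φ Ξ Γ (.term (.const c) T)) : Conv Φ A T := by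
  generalize hJ : Judgment.term (.const c) T = J at h
  induction h generalizing T with
  | conv hT _ _ ih _ => cases hJ; exact (ih rfl).trans hT
  | cons hc' _ => cases hJ; rw [hc.unique hΦ hc']; exact .refl _
  | _ => cases hJ

theorem pi_inv {Γ : Ctx} {A B T : Term} (h : Der Φ Ξ Γ (.term (.pi A B) T)) :
    Der Φ Ξ Γ (.term A (.sort .type)) ∧ ∃ s, Der Φ Ξ (.reg A :: Γ) (.term B (.sort s)) := by
  generalize hJ : Judgment.term (.pi A B) T = J at h
  induction h generalizing T with
  | conv hT _ _ ih _ => cases hJ; exact ih rfl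
  | arrow hA hB => cases hJ; exact ⟨hA, _, hB⟩
  | _ => cases hJ

theorem piC_inv {Γ : Ctx} {A B T : Term} (h : Der Φ Ξ Γ (.term (.piC A B) T)) :
    Der Φ Ξ Γ (.term A (.sort .type)) ∧ ∃ s, Der Φ Ξ (.conf A :: Γ) (.term B (.sort s)) := by
  generalize hJ : Judgment.term (.piC A B) T = J at h
  induction h generalizing T with
  | conv hT _ _ ih _ => cases hJ; exact ih rfl
  | arrowC hA hB => cases hJ; exact ⟨hA, _, hB⟩
  | _ => cases hJ

theorem lam_inv {Γ : Ctx} {t T : Term} (h : Der Φ Ξ Γ (.term (.lam t) T)) :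
    ∃ A B, Der Φ Ξ Γ (.term A (.sort .type)) ∧ Der Φ Ξ (.reg A :: Γ) (.term t B) ∧
      Conv Φ (.pi A B) T := by
  generalize hJ : Judgment.term (.lam t) T = J at h
  induction h generalizing T with
  | conv hT _ _ ih _ =>
    cases hJ
    obtain ⟨A, B, hA, ht, hAB⟩ := ih rfl
    exact ⟨A, B, hA, ht, hAB.trans hT⟩
  | abs hA _ ht => cases hJ; exact ⟨_, _, hA, ht, .refl _⟩
  | _ => cases hJ

theorem lamC_inv {Γ : Ctx} {t T : Term} (h : Der Φ Ξ Γ (.term (.lamC t) T)) :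
    ∃ A B, Der Φ Ξ Γ (.term A (.sort .type)) ∧ Der Φ Ξ (.conf A :: Γ) (.term t B) ∧
      Conv Φ (.piC A B) T := by
  generalize hJ : Judgment.term (.lamC t) T = J at h
  induction h generalizing T with
  | conv hT _ _ ih _ =>
    cases hJ
    obtain ⟨A, B, hA, ht, hAB⟩ := ih rfl
    exact ⟨A, B, hA, ht, hAB.trans hT⟩
  | absC hA _ ht => cases hJ; exact ⟨_, _, hA, ht, .refl _⟩
  | _ => cases hJ

theorem app_inv {Γ : Ctx} {t u T : Term} (h : Der Φ Ξ Γ (.term (.app t u) T)) :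
    ∃ A B, Der Φ Ξ Γ (.term t (.pi A B)) ∧ Der Φ Ξ Γ (.term u A) ∧ Conv Φ (B.inst u) T := by
  generalize hJ : Judgment.term (.app t u) T = J at h
  induction h generalizing T with
  | conv hT _ _ ih _ =>
    cases hJ
    obtain ⟨A, B, ht, hu, hB⟩ := ih rfl
    exact ⟨A, B, ht, hu, hB.trans hT⟩
  | app ht hu => cases hJ; exact ⟨_, _, ht, hu, .refl _⟩
  | _ => cases hJ

theorem appC_inv {Γ : Ctx} {t T : Term} {l : Level} (h : Der Φ Ξ Γ (.term (.appC t l) T)) :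
    ∃ A B, Der Φ Ξ Γ (.term t (.piC A B)) ∧ Der Φ Ξ Γ (.level l A) ∧ Conv Φ (B.instC l) T := by
  generalize hJ : Judgment.term (.appC t l) T = J at h
  induction h generalizing T with
  | conv hT _ _ ih _ =>
    cases hJ
    obtain ⟨A, B, ht, hu, hB⟩ := ih rfl
    exact ⟨A, B, ht, hu, hB.trans hT⟩
  | appC ht hu => cases hJ; exact ⟨_, _, ht, hu, .refl _⟩
  | _ => cases hJ

end Der

/-! ### Typing of the global constants -/

theorem Level.rename_id (l : Level) : l.rename id = l := by
  rw [rename_eq_subst]; exact l.subst_idx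

namespace Der

variable {Γ : Ctx}

theorem tTy {l : Level} (hl : Der Φ Ξ Γ (.level l tLvl)) :
    Der Φ Ξ Γ (.term (tTy l) (.sort .type)) :=
  .appC (B := .sort .type) (.cons (.glob .Ty) hl.wf) hl

theorem tTm {l : Level} {A : Term} (hl : Der Φ Ξ Γ (.level l tLvl))
    (hA : Der Φ Ξ Γ (.term A (UPP.tTy l))) : Der Φ Ξ Γ (.term (tTm l A) (.sort .type)) :=
  .app (A := UPP.tTy l) (B := .sort .type)
    (.appC (B := .pi (UPP.tTy (.idx 0)) (.sort .type)) (.cons (.glob .Tm) hl.wf) hl) hA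

theorem level_shift (hΦ : Φ.Regular) {l : Level} {A B : Term} (hl : Der Φ Ξ Γ (.level l A))
    (hB : Der Φ Ξ Γ (.term B (.sort .type))) : Der Φ Ξ (.reg B :: Γ) (.level l A.shift) := by
  have := hl.rename hΦ (Ctx.Ren.shift Γ B) (.extCtx hB)
  rwa [Judgment.rename, Level.rename_id] at this

theorem tmFamily (hΦ : Φ.Regular) {l l' : Level} {A : Term} (hl : Der Φ Ξ Γ (.level l tLvl))
    (hl' : Der Φ Ξ Γ (.level l' tLvl)) (hA : Der Φ Ξ Γ (.term A (UPP.tTy l))) :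
    Der Φ Ξ Γ (.term (.pi (UPP.tTm l A) (UPP.tTy l')) (.sort .type)) :=
  .arrow (tTm hl hA) (tTy (hl'.level_shift hΦ (tTm hl hA)))

theorem tmPi (hΦ : Φ.Regular) {l l' : Level} {A B : Term} (hl : Der Φ Ξ Γ (.level l tLvl))
    (hl' : Der Φ Ξ Γ (.level l' tLvl)) (hA : Der Φ Ξ Γ (.term A (UPP.tTy l)))
    (hB : Der Φ Ξ Γ (.term B (.pi (UPP.tTm l A) (UPP.tTy l')))) :
    Der Φ Ξ Γ (.term (.pi (UPP.tTm l A) (UPP.tTm l' (.app B.shift (.var 0)))) (.sort .type)) := by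
  have hT := tTm hl hA
  refine .arrow hT (tTm (hl'.level_shift hΦ hT) ?_)
  have := Der.app (hB.shift hΦ hT) (.var (.here _ _) (.extCtx hT))
  simpa [Term.shift, Term.rename, UPP.tTy, Term.inst, Term.subst, Level.rename_id,
    Level.subst_idx] using this

theorem tPi {l l' : Level} {A B : Term} (hl : Der Φ Ξ Γ (.level l tLvl))
    (hl' : Der Φ Ξ Γ (.level l' tLvl)) (hA : Der Φ Ξ Γ (.term A (UPP.tTy l)))
    (hB : Der Φ Ξ Γ (.term B (.pi (UPP.tTm l A) (UPP.tTy l')))) :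
    Der Φ Ξ Γ (.term (tPi l l' A B) (UPP.tTy (.sup l l'))) := by
  have h₁ := Der.appC (Γ := Γ) (.cons (Φ := Φ) (Ξ := Ξ) (.glob .Pi) hl.wf) hl
  have h₂ := Der.appC h₁ hl'
  have h₃ := Der.app (A := UPP.tTy l) (B := .pi (.pi (UPP.tTm l (.var 0)) (UPP.tTy l'))
    (UPP.tTy (.sup l l'))) (u := A) (by
      simpa [Term.instC, Term.subst, Level.subst, upSubC, upSub, UPP.tTy, UPP.tTm,
        Level.subst_rename, Level.subst_idx, Term.shiftC, Term.rename] using h₂) hA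
  have h₄ := Der.app (A := .pi (UPP.tTm l A) (UPP.tTy l')) (B := UPP.tTy (.sup l l')) (u := B) (by
    simpa [Term.inst, Term.subst, Level.subst, upSub, UPP.tTy, UPP.tTm, Level.subst_idx] using h₃)
    hB
  simpa [Term.inst, Term.subst, UPP.tTy, UPP.tPi, Level.subst_idx] using h₄

end Der

/-- Base case of validity: the types of the global constants are simply postulated, so each has to
be checked. Indices 1 and 0 are `l` and `l'`. -/
theorem Glob.type_typed (hΦ : Φ.Regular) (g : Glob) :
    ∃ s, Der Φ Ξ [] (.term g.type (.sort s)) := by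
  have h₀ : Der Φ Ξ [] .wf := .emptyCtx
  have h₁ : Der Φ Ξ [.conf tLvl] .wf := .extCtxC h₀.lvl
  have h₂ : Der Φ Ξ [.conf tLvl, .conf tLvl] .wf := .extCtxC h₁.lvl
  have l₁ : Der Φ Ξ [.conf tLvl] (.level (.idx 0) tLvl) := .varC (.here _ _) h₁
  have l : Der Φ Ξ [.conf tLvl, .conf tLvl] (.level (.idx 1) tLvl) :=
    .varC (.conf _ (.here _ _)) h₂
  have l' : Der Φ Ξ [.conf tLvl, .conf tLvl] (.level (.idx 0) tLvl) := .varC (.here _ _) h₂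
  have hA := l.tTy
  have lA := l.level_shift hΦ hA
  have lA' := l'.level_shift hΦ hA
  have hx : Der Φ Ξ [.reg (tTy (.idx 1)), .conf tLvl, .conf tLvl]
      (.term (.var 0) (tTy (.idx 1))) := .var (.here _ _) lA.wf
  have hB := Der.tmFamily hΦ lA lA' hx
  have lB := lA.level_shift hΦ hB
  have lB' := lA'.level_shift hΦ hB
  have hA' := hx.shift hΦ hB
  have hB' : Der Φ Ξ [.reg (.pi (tTm (.idx 1) (.var 0)) (tTy (.idx 0))), .reg (tTy (.idx 1)),
      .conf tLvl, .conf tLvl]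
      (.term (.var 0) (.pi (tTm (.idx 1) (.var 1)) (tTy (.idx 0)))) := .var (.here _ _) lB.wf
  have hP := Der.tPi lB lB' hA' hB'
  have hPT := Der.tTm (lB.sup lB') hP
  cases g with
  | Lvl => exact ⟨.kind, .sort h₀⟩
  | Ty => exact ⟨.kind, .arrowC h₀.lvl (.sort h₁)⟩
  | Tm => exact ⟨.kind, .arrowC h₀.lvl (.arrow l₁.tTy (.sort (.extCtx l₁.tTy)))⟩
  | U => exact ⟨.type, .arrowC h₀.lvl l₁.succ.tTy⟩
  | Pi =>
    exact ⟨.type, .arrowC h₀.lvl (.arrowC h₁.lvl (.arrow hA (.arrow hB (lB.sup lB').tTy)))⟩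
  | Lam =>
    have ht := Der.tmPi hΦ lB lB' hA' hB'
    exact ⟨.type, .arrowC h₀.lvl (.arrowC h₁.lvl (.arrow hA (.arrow hB
      (.arrow ht (hPT.shift hΦ ht)))))⟩
  | App =>
    have hu := (Der.tTm lB hA').shift hΦ hPT
    have hBu := Der.app (Γ := [.reg (tTm (.idx 1) (.var 2)),
        .reg (tTm (.sup (.idx 1) (.idx 0)) (tPi (.idx 1) (.idx 0) (.var 1) (.var 0))),
        .reg (.pi (tTm (.idx 1) (.var 0)) (tTy (.idx 0))), .reg (tTy (.idx 1)),
        .conf tLvl, .conf tLvl])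
      (A := tTm (.idx 1) (.var 3)) (B := tTy (.idx 0)) ((hB'.shift hΦ hPT).shift hΦ hu)
      (.var (.here _ _) (.extCtx hu))
    exact ⟨.type, .arrowC h₀.lvl (.arrowC h₁.lvl (.arrow hA (.arrow hB
      (.arrow hPT (.arrow hu (.tTm ((lB'.level_shift hΦ hPT).level_shift hΦ hu) hBu))))))⟩

/-! ### Validity and subject reduction -/

/-- A regular local signature whose declarations are well-typed in the signature itself. -/
structure LocalSig.Valid (Φ : LocalSig) : Prop extends Φ.Regular where
  type_typed : ∀ e ∈ Φ, e.type = .sort .kind ∨ ∃ s, Der Φ ∅ [] (.term e.type (.sort s))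
  body_typed : ∀ e ∈ Φ, ∀ t, e.body = some t → Der Φ ∅ [] (.term t e.type)

/-- The alternative `Kind` does occur: a definition is only required to have a typed body, and `Type
: Kind` is such a body. -/
theorem Declares.typed (hΦ : Φ.Valid) {c : Const} {A : Term} (hc : Declares Φ c A) {Γ : Ctx}
    (hw : Der Φ Ξ Γ .wf) : A = .sort .kind ∨ ∃ s, Der Φ Ξ Γ (.term A (.sort s)) := by
  cases hc with
  | glob g =>
    obtain ⟨s, hs⟩ := Glob.type_typed (Ξ := Ξ) hΦ.toRegular g
    exact .inr ⟨s, hs.of_nil hΦ.toRegular hw⟩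
  | loc he =>
    refine (hΦ.type_typed _ he).imp_right fun ⟨s, hs⟩ => ⟨s, ?_⟩
    exact (hs.mono (List.Subset.refl _) (Finset.empty_subset _)).of_nil hΦ.toRegular hw

namespace Der

variable {Γ : Ctx}

theorem hasVar_typed (hΦ : Φ.Regular) {n : ℕ} {A : Term} (hn : Ctx.HasVar Γ n A)
    (hw : Der Φ Ξ Γ .wf) : Der Φ Ξ Γ (.term A (.sort .type)) := by
  induction hn with
  | here Γ A => cases hw with | extCtx hA => exact hA.shift hΦ hA
  | reg B _ ih => cases hw with | extCtx hB => exact (ih hB.wf).shift hΦ hB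
  | conf B _ ih => cases hw with | extCtxC hB => exact (ih hB.wf).shiftC hΦ hB

theorem inst_typed (hΦ : Φ.Regular) {A B u : Term}
    (hB : Term.pi A B = .sort .kind ∨ ∃ s, Der Φ Ξ Γ (.term (.pi A B) (.sort s)))
    (hu : Der Φ Ξ Γ (.term u A)) : ∃ s, Der Φ Ξ Γ (.term (B.inst u) (.sort s)) := by
  obtain ⟨s, hs⟩ := hB.resolve_left (by simp)
  obtain ⟨_, s', hB⟩ := hs.pi_inv
  exact ⟨s', hB.inst hΦ hu⟩

theorem instC_typed (hΦ : Φ.Regular) {A B : Term} {l : Level}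
    (hB : Term.piC A B = .sort .kind ∨ ∃ s, Der Φ Ξ Γ (.term (.piC A B) (.sort s)))
    (hl : Der Φ Ξ Γ (.level l A)) : ∃ s, Der Φ Ξ Γ (.term (B.instC l) (.sort s)) := by
  obtain ⟨s, hs⟩ := hB.resolve_left (by simp)
  obtain ⟨_, s', hB⟩ := hs.piC_inv
  exact ⟨s', hB.instC hΦ hl⟩

/-- The type of a term is `Kind` or is itself typed by a sort. -/
theorem type_typed (hΦ : Φ.Valid) {t A : Term} (h : Der Φ Ξ Γ (.term t A)) :
    A = .sort .kind ∨ ∃ s, Der Φ Ξ Γ (.term A (.sort s)) := by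
  generalize hJ : Judgment.term t A = J at h
  induction h generalizing t A with
  | sort => cases hJ; exact .inl rfl
  | var hn hw => cases hJ; exact .inr ⟨_, hasVar_typed hΦ.toRegular hn hw⟩
  | cons hc hw => cases hJ; exact hc.typed hΦ hw
  | conv _ _ hB => cases hJ; exact .inr ⟨_, hB⟩
  | @arrow _ _ _ s hA =>
    cases hJ
    cases s with
    | type => exact .inr ⟨_, .sort hA.wf⟩
    | kind => exact .inl rfl
  | @arrowC _ _ _ s hA =>
    cases hJ
    cases s with
    | type => exact .inr ⟨_, .sort hA.wf⟩
    | kind => exact .inl rfl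
  | abs hA hB => cases hJ; exact .inr ⟨_, .arrow hA hB⟩
  | absC hA hB => cases hJ; exact .inr ⟨_, .arrowC hA hB⟩
  | app _ hu ih => cases hJ; exact .inr (inst_typed hΦ.toRegular (ih rfl) hu)
  | appC _ hl ih => cases hJ; exact .inr (instC_typed hΦ.toRegular (ih rfl) hl)
  | _ => cases hJ

/-- If every type of `f` is convertible to `piC P Q`, then an application of `f` is typed
accordingly. -/
theorem appC_spine (hΦ : Φ.Regular) {f P Q T : Term} {l : Level}
    (hf : ∀ T, Der Φ Ξ Γ (.term f T) → Conv Φ (.piC P Q) T)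
    (h : Der Φ Ξ Γ (.term (.appC f l) T)) :
    (∃ A, Der Φ Ξ Γ (.term f A)) ∧ (∃ P', Der Φ Ξ Γ (.level l P') ∧ Conv Φ P' P) ∧
      Conv Φ (Q.instC l) T := by
  obtain ⟨A, B, ht, hl, hT⟩ := h.appC_inv
  obtain ⟨hP, hQ⟩ := (hf _ ht).piC_inj hΦ
  exact ⟨⟨_, ht⟩, ⟨A, hl, hP.symm⟩, (hQ.instC hΦ l).trans hT⟩

/-- If every type of `f` is convertible to `pi P Q`, then an application of `f` is typed
accordingly. -/
theorem app_spine (hΦ : Φ.Regular) {f P Q T u : Term}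
    (hf : ∀ T, Der Φ Ξ Γ (.term f T) → Conv Φ (.pi P Q) T)
    (h : Der Φ Ξ Γ (.term (.app f u) T)) :
    (∃ A, Der Φ Ξ Γ (.term f A)) ∧ (∃ P', Der Φ Ξ Γ (.term u P') ∧ Conv Φ P' P) ∧
      Conv Φ (Q.inst u) T := by
  obtain ⟨A, B, ht, hu, hT⟩ := h.app_inv
  obtain ⟨hP, hQ⟩ := (hf _ ht).pi_inj hΦ
  exact ⟨⟨_, ht⟩, ⟨A, hu, hP.symm⟩, (hQ.inst hΦ u).trans hT⟩

/-- The type that the constants `λ` and `@` have once applied to two levels, a type and a family,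
for a declared type with codomain `X`. -/
theorem family_spine (hΦ : Φ.Regular) {c : Glob} {X : Term}
    (hc : c.type = .piC UPP.tLvl (.piC UPP.tLvl (.pi (UPP.tTy (.idx 1))
      (.pi (.pi (UPP.tTm (.idx 1) (.var 0)) (UPP.tTy (.idx 0))) X))))
    {l l' : Level} {A B T : Term}
    (h : Der Φ Ξ Γ (.term (.app (.app (.appC (.appC (.const (.glob c)) l) l') A) B) T)) :
    Der Φ Ξ Γ (.level l tLvl) ∧ Der Φ Ξ Γ (.level l' tLvl) ∧ Der Φ Ξ Γ (.term A (UPP.tTy l)) ∧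
      Der Φ Ξ Γ (.term B (.pi (UPP.tTm l A) (UPP.tTy l'))) ∧
      Conv Φ (X.subst (fun n => match n with | 0 => B | 1 => A | n + 2 => .var n)
        (fun n => match n with | 0 => l' | 1 => l | n + 2 => .idx n)) T := by
  have p₀ : ∀ T, Der Φ Ξ Γ (.term (.const (.glob c)) T) → _ := fun T h =>
    h.const_inv hΦ (.glob c)
  rw [hc] at p₀
  have p₁ : ∀ T, Der Φ Ξ Γ (.term (.appC (.const (.glob c)) l) T) → _ := fun T h =>
    (appC_spine hΦ p₀ h).2.2
  have p₂ : ∀ T, Der Φ Ξ Γ (.term (.appC (.appC (.const (.glob c)) l) l') T) → _ := fun T h =>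
    (appC_spine hΦ p₁ h).2.2
  have p₃ : ∀ T, Der Φ Ξ Γ (.term (.app (.appC (.appC (.const (.glob c)) l) l') A) T) → _ :=
    fun T h => (app_spine hΦ p₂ h).2.2
  obtain ⟨⟨T₃, h₃⟩, ⟨PB, hB, eB⟩, hT⟩ := app_spine hΦ p₃ h
  obtain ⟨⟨T₂, h₂⟩, ⟨PA, hA, eA⟩, -⟩ := app_spine hΦ p₂ h₃
  obtain ⟨⟨T₁, h₁⟩, ⟨P', hl', e'⟩, -⟩ := appC_spine hΦ p₁ h₂
  obtain ⟨-, ⟨P, hl, e⟩, -⟩ := appC_spine hΦ p₀ h₁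
  have hl := Der.convC e hl hl.wf.lvl
  have hl' := Der.convC e' hl' hl.wf.lvl
  have hA := Der.conv (B := UPP.tTy l) (by
    simpa [Term.instC, Term.subst, Level.subst, upSubC, upSub, UPP.tTy, UPP.tTm,
        Level.subst_rename, Level.subst_idx, Term.shiftC, Term.rename] using eA) hA hl.tTy
  have hB := Der.conv (B := .pi (UPP.tTm l A) (UPP.tTy l')) (by
    simpa [Term.instC, Term.inst, Term.subst, Level.subst, upSubC, upSub, UPP.tTy, UPP.tTm,
      Level.subst_rename, Level.subst_idx, Term.shiftC, Term.rename] using eB)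
    hB (tmFamily hΦ hl hl' hA)
  refine ⟨hl, hl', hA, hB, ?_⟩
  -- The four successive instantiations are merged into one simultaneous substitution, then compared
  -- with the stated one index by index.
  simp only [Term.inst, Term.subst_subst, Level.subst_subst] at hT
  convert hT using 2
  · funext n
    match n with
    | 0 => rfl
    | 1 => simp [upSub, Term.subst, Term.shift, Term.subst_rename, Term.subst_var]
    | n + 2 => rfl
  · funext n
    match n with
    | 0 => simp [upSubC, Level.subst, Level.subst_idx]
    | 1 => simp [upSubC, Level.subst_rename, Level.subst_idx, Level.subst]
    | n + 2 => simp [upSubC, Level.subst, Level.rename]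

/-- Contracting a well-typed application of `@` to a `λ` preserves its types. -/
theorem contract_appLam (hΦ : Φ.Regular) {l l' m m' : Level} {A B A' B' t u T : Term}
    (h : Der Φ Ξ Γ (.term (tApp l l' A B (tLam m m' A' B' t) u) T)) :
    ∃ T', Der Φ Ξ Γ (.term (.app t u) T') ∧ Conv Φ T' T := by
  have p₄ : ∀ T, Der Φ Ξ Γ (.term (.app (.app (.appC (.appC (.const (.glob .App)) l) l') A) B) T) →
      Conv Φ (.pi (UPP.tTm (.sup l l') (UPP.tPi l l' A B))
        (.pi (UPP.tTm l A.shift) (UPP.tTm l' (.app B.shift.shift (.var 0))))) T := by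
    intro T h
    have := (family_spine hΦ rfl h).2.2.2.2
    exact this
  have p₅ : ∀ w T, Der Φ Ξ Γ (.term (.app (.app (.app (.appC (.appC (.const (.glob .App)) l) l') A)
      B) w) T) → Conv Φ (.pi (UPP.tTm l A) (UPP.tTm l' (.app B.shift (.var 0)))) T := by
    intro w T h
    have := (app_spine hΦ p₄ h).2.2
    simpa [Term.inst, Term.subst, UPP.tTm, Term.shift, Term.subst_rename, Term.rename_eq_subst,
      Term.subst_subst, upSub, Level.subst_idx, Term.subst_var, Term.rename] using this
  have q₄ : ∀ T, Der Φ Ξ Γ (.term (.app (.app (.appC (.appC (.const (.glob .Lam)) m) m') A')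
      B') T) → Conv Φ (.pi (.pi (UPP.tTm m A') (UPP.tTm m' (.app B'.shift (.var 0))))
        (UPP.tTm (.sup m m') (UPP.tPi m m' A'.shift B'.shift))) T := by
    intro T h
    have := (family_spine hΦ rfl h).2.2.2.2
    exact this
  obtain ⟨⟨_, hw⟩, ⟨Pu, hu, eu⟩, hT⟩ := app_spine hΦ (p₅ _) h
  obtain ⟨-, ⟨Pw, hw, ew⟩, -⟩ := app_spine hΦ p₄ hw
  obtain ⟨⟨_, hL⟩, ⟨Pt, ht, et⟩, hPw⟩ := app_spine hΦ q₄ hw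
  obtain ⟨hl, hl', hA', hB', -⟩ := family_spine hΦ rfl hL
  have hP : (UPP.tTm (.sup m m') (UPP.tPi m m' A'.shift B'.shift)).inst t =
      UPP.tTm (.sup m m') (UPP.tPi m m' A' B') := by
    simp [UPP.tTm, UPP.tPi, Term.inst, Term.subst, Term.shift, Term.subst_rename, Level.subst_idx,
      Term.subst_var]
  rw [hP] at hPw
  -- The `λ` term has one `Tm`-`Π` type from its own annotations and another as the argument of `@`;
  -- injectivity identifies the two sets of annotations.
  obtain ⟨el, el', eA, eB⟩ := (hPw.trans ew).tTm_tPi_inj hΦ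
  have ht := Der.conv et ht (tmPi hΦ hl hl' hA' hB')
  have hu := Der.conv (eu.trans ((Conv.appC (.refl _) el.symm).app eA.symm)) hu (tTm hl hA')
  refine ⟨_, .app ht hu, Conv.trans ?_ hT⟩
  simp only [Term.inst, Term.subst, UPP.tTm, Level.subst_idx]
  refine (Conv.appC (.refl _) el').app (Conv.app ?_ (.refl _))
  -- The codomains are `B' u` and `B u`, where both families occur shifted and then instantiated.
  rwa [← Term.inst_shift B u, ← Term.inst_shift B' u] at eB

/-- Typing the redex types `U l`, hence `l : Lvl`; both sides of the rule then have type `Type`. -/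
theorem contract_tmU (hΦ : Φ.Regular) {l' l : Level} {T : Term}
    (h : Der Φ Ξ Γ (.term (UPP.tTm l' (tU l)) T)) :
    ∃ T', Der Φ Ξ Γ (.term (UPP.tTy l) T') ∧ Conv Φ T' T := by
  obtain ⟨-, ⟨_, hU, -⟩, hT⟩ := app_spine hΦ (P := UPP.tTy l') (Q := .sort .type)
    (fun T h => (appC_spine hΦ (fun T h => h.const_inv hΦ (.glob .Tm)) h).2.2) h
  obtain ⟨-, ⟨_, hl, e⟩, -⟩ := appC_spine hΦ (fun T h => h.const_inv hΦ (.glob .U)) hU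
  exact ⟨_, tTy (.convC e hl hl.wf.lvl), hT⟩

/-- Contracting a redex preserves its types up to conversion. -/
theorem contract (hΦ : Φ.Valid) {t t' T : Term} (hc : Contracts Φ t t')
    (h : Der Φ Ξ Γ (.term t T)) : ∃ T', Der Φ Ξ Γ (.term t' T') ∧ Conv Φ T' T := by
  cases hc with
  | beta t u =>
    obtain ⟨A, B, ht, hu, hT⟩ := h.app_inv
    obtain ⟨A', B', hA', ht, hAB⟩ := ht.lam_inv
    obtain ⟨hA, hB⟩ := hAB.pi_inj hΦ.toRegular
    exact ⟨_, ht.inst hΦ.toRegular (.conv hA.symm hu hA'), (hB.inst hΦ.toRegular u).trans hT⟩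
  | betaC t l =>
    obtain ⟨A, B, ht, hl, hT⟩ := h.appC_inv
    obtain ⟨A', B', hA', ht, hAB⟩ := ht.lamC_inv
    obtain ⟨hA, hB⟩ := hAB.piC_inj hΦ.toRegular
    exact ⟨_, ht.instC hΦ.toRegular (.convC hA.symm hl hA'), (hB.instC hΦ.toRegular l).trans hT⟩
  | delta he ht =>
    have := (hΦ.body_typed _ he _ ht).mono (List.Subset.refl _) (Finset.empty_subset Ξ)
    exact ⟨_, this.of_nil hΦ.toRegular h.wf, h.const_inv hΦ.toRegular (.loc he)⟩
  | tmU l' l => exact contract_tmU hΦ.toRegular h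
  | appLam => exact contract_appLam hΦ.toRegular h

/-- Subject reduction, by induction on the typing derivation so that conversions are passed over. A
contractum gets its type only up to conversion; validity gives the sort needed to convert back
exactly. -/
theorem step (hΦ : Φ.Valid) {t t' A : Term} (h : Der Φ Ξ Γ (.term t A)) (ht : Step Φ t t') :
    Der Φ Ξ Γ (.term t' A) := by
  generalize hJ : Judgment.term t A = J at h
  induction h generalizing t t' A with
  | sort => cases hJ; cases ht with | root hc => cases hc
  | var => cases hJ; cases ht with | root hc => cases hc
  | cons hc hw =>
    cases hJ
    cases ht with
    | root hr =>
      cases hr with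
      | delta he ht =>
        cases hc.unique hΦ.toRegular (.loc he)
        exact ((hΦ.body_typed _ he _ ht).mono (List.Subset.refl _)
          (Finset.empty_subset _)).of_nil hΦ.toRegular hw
  | conv hAB _ hB ih => cases hJ; exact .conv hAB (ih ht rfl) hB
  | arrow hA hB ihA ihB =>
    cases hJ
    cases ht with
    | root hc => cases hc
    | pi_dom _ hs =>
      have hA' := ihA hs rfl
      -- The codomain was typed over the old domain, so its context is changed along the reduction.
      exact .arrow hA' (hB.conv_ctx hΦ.toRegular (.of_step hs) hA hA')
    | pi_cod _ hs => exact .arrow hA (ihB hs rfl)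
  | arrowC hA hB ihA ihB =>
    cases hJ
    cases ht with
    | root hc => cases hc
    | piC_dom _ hs =>
      have hA' := ihA hs rfl
      exact .arrowC hA' (hB.conv_ctxC hΦ.toRegular (.of_step hs) hA hA')
    | piC_cod _ hs => exact .arrowC hA (ihB hs rfl)
  | abs hA hB _ _ _ iht =>
    cases hJ
    cases ht with
    | root hc => cases hc
    | lam hs => exact .abs hA hB (iht hs rfl)
  | absC hA hB _ _ _ iht =>
    cases hJ
    cases ht with
    | root hc => cases hc
    | lamC hs => exact .absC hA hB (iht hs rfl)
  | app hf hu ihf ihu =>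
    cases hJ
    obtain ⟨s, hB⟩ := inst_typed hΦ.toRegular (hf.type_typed hΦ) hu
    cases ht with
    | root hc =>
      obtain ⟨T', hv, hT⟩ := contract hΦ hc (.app hf hu)
      exact .conv hT hv hB
    | app_fun _ hs => exact .app (ihf hs rfl) hu
    | app_arg _ hs =>
      -- Reducing the argument also changes the type, from `B[u]` to the convertible `B[u']`.
      exact .conv (.symm (.of_par ((Par.refl _).inst hΦ.toRegular hs.par))) (.app hf (ihu hs rfl)) hB
  | appC hf hl ihf =>
    cases hJ
    obtain ⟨s, hB⟩ := instC_typed hΦ.toRegular (hf.type_typed hΦ) hl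
    cases ht with
    | root hc =>
      obtain ⟨T', hv, hT⟩ := contract hΦ hc (.appC hf hl)
      exact .conv hT hv hB
    | appC _ hs => exact .appC (ihf hs rfl) hl
  | _ => cases hJ

theorem red (hΦ : Φ.Valid) {t t' A : Term} (h : Der Φ Ξ Γ (.term t A)) (ht : Red Φ t t') :
    Der Φ Ξ Γ (.term t' A) := by
  induction ht with
  | refl => exact h
  | tail _ hs ih => exact ih.step hΦ hs

end Der

/-- Each entry is checked over the preceding ones; `Der.closed` gives closedness and `Der.mono`
carries the typings to the larger signature. -/
theorem LocalSig.WellFormed.valid (h : Φ.WellFormed) : Φ.Valid := by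
  induction h with
  | nil => exact ⟨⟨by simp, by simp, by simp⟩, by simp, by simp⟩
  | @decl Φ c A s _ hc hA ih =>
    have hs : Φ ⊆ ⟨c, A, none⟩ :: Φ := List.subset_cons_self _ _
    refine ⟨⟨?_, ?_, ?_⟩, ?_, ?_⟩
    · exact List.forall_mem_cons.2 ⟨hA.closed, ih.type_closed⟩
    · exact List.forall_mem_cons.2 ⟨fun _ ht => (nomatch ht), ih.body_closed⟩
    · simp only [List.mem_cons]
      rintro e (rfl | he) e' (rfl | he') hn
      · rfl
      · exact absurd hn.symm (hc _ he')
      · exact absurd hn (hc _ he)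
      · exact ih.unique _ he _ he' hn
    · refine List.forall_mem_cons.2 ⟨.inr ⟨s, hA.mono hs (subset_refl _)⟩, fun e he => ?_⟩
      exact (ih.type_typed e he).imp_right fun ⟨s, h⟩ => ⟨s, h.mono hs (subset_refl _)⟩
    · exact List.forall_mem_cons.2 ⟨fun _ ht => (nomatch ht), fun e he t ht =>
        (ih.body_typed e he t ht).mono hs (subset_refl _)⟩
  | @defn Φ c A t _ hc ht ih =>
    have hs : Φ ⊆ ⟨c, A, some t⟩ :: Φ := List.subset_cons_self _ _
    -- A definition comes without a judgment on its type; validity over the preceding entries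
    -- supplies it.
    have hA := ht.type_typed ih
    refine ⟨⟨?_, ?_, ?_⟩, ?_, ?_⟩
    · refine List.forall_mem_cons.2 ⟨?_, ih.type_closed⟩
      rcases hA with rfl | ⟨s, hA⟩
      · exact ⟨fun _ _ => rfl, fun _ => rfl⟩
      · exact hA.closed
    · refine List.forall_mem_cons.2 ⟨?_, ih.body_closed⟩
      rintro _ ⟨⟩
      exact ht.closed
    · simp only [List.mem_cons]
      rintro e (rfl | he) e' (rfl | he') hn
      · rfl
      · exact absurd hn.symm (hc _ he')
      · exact absurd hn (hc _ he)
      · exact ih.unique _ he _ he' hn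
    · refine List.forall_mem_cons.2
        ⟨hA.imp_right fun ⟨s, h⟩ => ⟨s, h.mono hs (subset_refl _)⟩, fun e he => ?_⟩
      exact (ih.type_typed e he).imp_right fun ⟨s, h⟩ => ⟨s, h.mono hs (subset_refl _)⟩
    · refine List.forall_mem_cons.2 ⟨?_, fun e he t ht =>
        (ih.body_typed e he t ht).mono hs (subset_refl _)⟩
      rintro _ ⟨⟩
      exact ht.mono hs (subset_refl _)

/-! ### Level substitutions -/

/-- Left-hand sides place no condition on levels, and bodies of definitions contain no level
variable that θ could alter. -/
theorem Contracts.lsubst (hΦ : Φ.Regular) (θ : LevelSubst) {t u : Term} (h : Contracts Φ t u) :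
    Contracts Φ (t.lsubst θ) (u.lsubst θ) := by
  cases h with
  | beta t u => rw [Term.lsubst_inst]; exact .beta _ _
  | betaC t l => rw [Term.lsubst_instC]; exact .betaC _ _
  | delta he ht => rw [(hΦ.body_closed _ he _ ht).lsubst]; exact .delta he ht
  | tmU l' l => exact .tmU _ _
  | appLam => exact .appLam _ _ _ _ _ _ _ _ _ _

theorem Step.lsubst (hΦ : Φ.Regular) (θ : LevelSubst) {t u : Term} (h : Step Φ t u) :
    Step Φ (t.lsubst θ) (u.lsubst θ) := by
  induction h with
  | root h => exact .root (h.lsubst hΦ θ)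
  | pi_dom B _ ih => exact .pi_dom _ ih
  | pi_cod A _ ih => exact .pi_cod _ ih
  | lam _ ih => exact .lam ih
  | app_fun u _ ih => exact .app_fun _ ih
  | app_arg t _ ih => exact .app_arg _ ih
  | piC_dom B _ ih => exact .piC_dom _ ih
  | piC_cod A _ ih => exact .piC_cod _ ih
  | lamC _ ih => exact .lamC ih
  | appC l _ ih => exact .appC _ ih

theorem Red.lsubst (hΦ : Φ.Regular) (θ : LevelSubst) {t u : Term} (h : Red Φ t u) :
    Red Φ (t.lsubst θ) (u.lsubst θ) := by
  induction h with
  | refl => exact .refl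
  | tail _ hs ih => exact ih.tail (hs.lsubst hΦ θ)

theorem LevelSubst.Satisfies.mono {θ : LevelSubst} {C C' : Set Constraint}
    (h : θ.Satisfies C') (hC : C ⊆ C') : θ.Satisfies C := fun e he => h e (hC he)

/-- Constrained conversion is sound for conversion. -/
theorem ConvC.conv (hΦ : Φ.Regular) {θ : LevelSubst} {m : ConvMode} {A B : Term}
    {C : Set Constraint} (h : ConvC Φ m A B C) (hθ : θ.Satisfies C) :
    Conv Φ (A.lsubst θ) (B.lsubst θ) := by
  induction h with
  | reduce hA hB _ ih =>
    exact (Conv.of_red (hA.1.lsubst hΦ θ)).trans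
      ((ih hθ).trans (Conv.of_red (hB.1.lsubst hΦ θ)).symm)
  | var n => exact .refl _
  | const c => exact .refl _
  | sort s => exact .refl _
  | lam _ ih => exact (ih hθ).lam
  | pi _ _ ihA ihB =>
    exact (ihA (hθ.mono Set.subset_union_left)).pi (ihB (hθ.mono Set.subset_union_right))
  | app _ _ iht ihu =>
    exact (iht (hθ.mono Set.subset_union_left)).app (ihu (hθ.mono Set.subset_union_right))
  | appC l l' _ ih =>
    exact (ih (hθ.mono Set.subset_union_left)).appC (hθ (l, l') (by simp))

theorem Ctx.HasVar.lsubst (θ : LevelSubst) {Γ : Ctx} {n : ℕ} {A : Term} (h : Γ.HasVar n A) :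
    (Γ.lsubst θ).HasVar n (A.lsubst θ) := by
  induction h with
  | here Γ A => rw [Term.shift, Term.lsubst_rename]; exact .here _ _
  | reg B _ ih => rw [Term.shift, Term.lsubst_rename]; exact .reg _ ih
  | conf B _ ih => rw [Term.shiftC, Term.lsubst_rename]; exact .conf _ ih

theorem Level.IdxFree.typed {l : Level} (hl : l.IdxFree) (hΞ : l.names ⊆ Ξ) {Γ : Ctx}
    (hw : Der Φ Ξ Γ .wf) : Der Φ Ξ Γ (.level l tLvl) := by
  induction l with
  | name i => exact .varΞ (hΞ (Finset.mem_singleton_self i)) hw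
  | idx n => exact hl.elim
  | zero => exact .zero hw
  | succ l ih => exact .succ (ih hl hΞ)
  | sup l l' ih ih' =>
    exact .sup (ih hl.1 (Finset.union_subset_left hΞ)) (ih' hl.2 (Finset.union_subset_right hΞ))

/-! ### Schematic constants -/

theorem piLvls_subst (k : ℕ) (B : Term) (τ : ℕ → Level) :
    (piLvls k B).subst .var τ = piLvls k (B.subst .var (upSubC^[k] τ)) := by
  induction k generalizing τ with
  | zero => rfl
  | succ k ih => exact congrArg _ (ih _)

theorem piLvls_lsubst (θ : LevelSubst) (k : ℕ) (B : Term) :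
    (piLvls k B).lsubst θ = piLvls k (B.lsubst θ) := by
  induction k with
  | zero => rfl
  | succ k ih => exact congrArg _ ih

/-- Applying a constant to its first level substitutes below the remaining product binders, whereas
the `foldr` performs that instantiation last. The two commute because the remaining levels have no
index. -/
theorem foldr_instC_subst {ls : List Level} (hls : ∀ l ∈ ls, l.IdxFree) (B : Term)
    (τ : ℕ → Level) :
    ls.foldr (fun l B => B.instC l) (B.subst .var (upSubC^[ls.length] τ)) =
      (ls.foldr (fun l B => B.instC l) B).subst .var τ := by
  induction ls generalizing τ with
  | nil => rfl
  | cons l ls ih =>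
    have ih := ih (fun l hl => hls l (.tail _ hl)) (upSubC τ)
    rw [List.foldr_cons, List.length_cons, Function.iterate_succ_apply, ih, List.foldr_cons,
      Term.subst_instC, (hls l (.head _)).subst_eq]
    rfl

theorem Der.foldl_appC {Γ : Ctx} {ls : List Level} (hls : ∀ l ∈ ls, l.IdxFree)
    (hl : ∀ l ∈ ls, Der Φ Ξ Γ (.level l tLvl)) {t B : Term}
    (ht : Der Φ Ξ Γ (.term t (piLvls ls.length B))) :
    Der Φ Ξ Γ (.term (ls.foldl .appC t) (ls.foldr (fun l B => B.instC l) B)) := by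
  induction ls generalizing t B with
  | nil => exact ht
  | cons l ls ih =>
    have h := Der.appC ht (hl l (.head _))
    rw [Term.instC, piLvls_subst] at h
    have := ih (fun l hl => hls l (.tail _ hl)) (fun l h => hl l (.tail _ h)) h
    rwa [foldr_instC_subst fun l hl => hls l (.tail _ hl)] at this

theorem Term.appNames_lsubst (θ : LevelSubst) (t : Term) (is : List ℕ) :
    (t.appNames is).lsubst θ = (is.map θ.toFun).foldl .appC (t.lsubst θ) := by
  induction is generalizing t with
  | nil => rfl
  | cons i is ih => exact ih _

theorem Term.instNames_lsubst (θ : LevelSubst) (B : Term) (is : List ℕ) :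
    (B.instNames is).lsubst θ = (is.map θ.toFun).foldr (fun l B => B.instC l) (B.lsubst θ) := by
  induction is with
  | nil => rfl
  | cons i is ih =>
    rw [List.map_cons, List.foldr_cons, ← ih, instNames, List.foldr_cons, lsubst_instC]
    rfl

/-- Used to see that the level variables inserted after a constant belong to `V`. -/
theorem Term.names_appNames (t : Term) (is : List ℕ) :
    (t.appNames is).names = t.names ∪ is.toFinset := by
  induction is generalizing t with
  | nil => simp [appNames]
  | cons i is ih =>
    rw [appNames, List.foldl_cons, ← appNames, ih]
    ext j; simp [names, Level.names]

/-! ### Soundness of the bidirectional system -/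

/-- Soundness of the bidirectional system for a level substitution that satisfies the computed
constraints. -/
theorem Bidi.sound (hΦ : Φ.Valid) {V : Finset ℕ} {θ : LevelSubst} {m : Mode} {Γ : Ctx}
    {D C : Set Constraint} {t A : Term} (h : Bidi Φ m Γ D t A C) (hθ : θ.Satisfies C)
    (ht : t.names ⊆ V) :
    match m with
    | .check => ∀ s, Der Φ (levelCtx V θ) (Γ.lsubst θ) (.term (A.lsubst θ) (.sort s)) →
        Der Φ (levelCtx V θ) (Γ.lsubst θ) (.term (t.lsubst θ) (A.lsubst θ))
    | .infer => Der Φ (levelCtx V θ) (Γ.lsubst θ) .wf →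
        Der Φ (levelCtx V θ) (Γ.lsubst θ) (.term (t.lsubst θ) (A.lsubst θ)) := by
  induction h with
  | switch _ hAB ih =>
    intro s hB
    exact .conv (hAB.conv hΦ.toRegular (hθ.mono Set.subset_union_right))
      (ih (hθ.mono Set.subset_union_left) ht hB.wf) hB
  | abs hT _ ih =>
    intro s hT'
    have hr := hT.1.lsubst hΦ.toRegular θ
    -- By subject reduction the exposed product is well-formed, which gives the sort of the codomain
    -- required to check the body.
    obtain ⟨hA, s', hB⟩ := (hT'.red hΦ hr).pi_inv
    exact .conv (Conv.of_red hr).symm (.abs hA hB (ih hθ ht s' hB)) hT'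
  | var D hn => exact fun hw => .var (hn.lsubst θ) hw
  | @cons c B Γ D is hc =>
    intro hw
    have hT : Der Φ (levelCtx V θ) (Γ.lsubst θ) (.term (.const c) (piLvls is.length B)) :=
      .cons hc hw
    -- The whole declared type is fixed by θ, so θ may be inserted and pushed onto `B`.
    rw [← (hc.closed hΦ.toRegular).lsubst θ, piLvls_lsubst,
      ← List.length_map (as := is) θ.toFun] at hT
    rw [Term.appNames_lsubst, Term.instNames_lsubst]
    rw [Term.names_appNames] at ht
    refine Der.foldl_appC (t := .const c) ?_ ?_ hT
    · simp only [List.mem_map]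
      rintro _ ⟨i, -, rfl⟩
      exact θ.idxFree i
    · simp only [List.mem_map]
      rintro _ ⟨i, hi, rfl⟩
      refine (θ.idxFree i).typed ?_ hw
      exact Finset.subset_biUnion_of_mem (fun i => (θ.toFun i).names) (ht (by simp [hi]))
  | sort Γ D => exact fun hw => .sort hw
  | @pi Γ D A B T s C₁ C₂ _ _ hT ihA ihB =>
    intro hw
    have hA := ihA (hθ.mono Set.subset_union_left) (Finset.union_subset_left ht) .kind (.sort hw)
    have hB := ihB (hθ.mono Set.subset_union_right) (Finset.union_subset_right ht) (.extCtx hA)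
    have hr : Red Φ (T.lsubst θ) (.sort s) := hT.1.lsubst hΦ.toRegular θ
    refine .arrow hA ?_
    -- If the inferred type is `Kind` it has no sort to convert with, but then the sort it reduces
    -- to must be `Kind` itself.
    rcases hB.type_typed hΦ with hK | ⟨s', hs'⟩
    · rw [hK] at hr hB
      exact (Conv.of_red hr).sort_inj hΦ.toRegular ▸ hB
    · exact .conv (.of_red hr) hB (hs'.red hΦ hr)
  | @app Γ D t u T A B C₁ C₂ _ hT _ iht ihu =>
    intro hw
    have ht' := iht (hθ.mono Set.subset_union_left) (Finset.union_subset_left ht) hw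
    have hr : Red Φ (T.lsubst θ) (.pi (A.lsubst θ) (B.lsubst θ)) := hT.1.lsubst hΦ.toRegular θ
    rw [Term.lsubst_inst]
    rcases ht'.type_typed hΦ with hK | ⟨s, hs⟩
    · rw [hK] at hr
      -- `Kind` is neither a product nor reducible, so it cannot be the type of the function.
      obtain ⟨_, h, _⟩ := (Relation.ReflTransGen.cases_head hr).resolve_left (by simp)
      cases h with | root hc => cases hc
    · have hP := hs.red hΦ hr
      exact .app (.conv (.of_red hr) ht' hP)
        (ihu (hθ.mono Set.subset_union_right) (Finset.union_subset_right ht) _ hP.pi_inv.1)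

end UPP

/-- A solution of the union solves `C`, which the induction uses, and `D`, which provides the
formation hypothesis at that solution. -/
theorem mainTheorem3 (Φ : UPP.LocalSig) (hΦ : Φ.WellFormed) (V : Finset ℕ)
    (Γ : UPP.Ctx) (D C : Set UPP.Constraint) (t A : UPP.Term) (ht : t.names ⊆ V) :
    (∀ s : UPP.Srt, UPP.TypedUnder Φ V D Γ A (.sort s) → UPP.Bidi Φ .check Γ D t A C →
      UPP.TypedUnder Φ V (C ∪ D) Γ t A) ∧
    (UPP.WfUnder Φ V D Γ → UPP.Bidi Φ .infer Γ D t A C →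
      UPP.TypedUnder Φ V (C ∪ D) Γ t A) :=
  ⟨fun s hA h _ hθ => h.sound hΦ.valid (hθ.mono Set.subset_union_left) ht s
      (hA _ (hθ.mono Set.subset_union_right)),
    fun hΓ h _ hθ => h.sound hΦ.valid (hθ.mono Set.subset_union_left) ht
      (hΓ _ (hθ.mono Set.subset_union_right))⟩
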